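/- Consider $N\ge 1$ flywheels with positive inertias $I_i$, friction coefficients $B_{vi}$ and maximal angular velocities $\omega_{i\max}$; put $\gamma_i=1/\omega_{i\max}^2$. The state of energy $\phi_i$ of flywheel $i$ obeys $$\dot\phi_i=-\frac{2B_{vi}}{I_i}\phi_i-\frac{2\gamma_i}{I_i}P_{i,out},\qquad i=1,\dots,N,$$ with control input $P_{i,out}$, and $P_{FESMS}=\sum_{i=1}^N P_{i,out}$. Let $S_0\in\mathbb R^{q\times q}$ and $C_0\in\mathbb R^{1\times q}$ be constant, and let $$\alpha_0=\frac{2\sum_{i=1}^N B_{vi}/\gamma_i}{\sum_{i=1}^N I_i/\gamma_i},\qquad \beta_0=\frac{2}{\sum_{i=1}^N I_i/\gamma_i}.$$ The augmented command generator is $$\dot\eta_0=S_0\eta_0,\qquad P_{REF}=C_0\eta_0,\qquad \dot\psi_0=-\alpha_0\psi_0-\beta_0P_{REF}.$$ Let $\bar{\mathcal G}_1,\dots,\bar{\mathcal G}_n$ be digraphs on the nodes $\{0,1,\dots,N\}$ ($0$ is the command generator, $i\ge1$ is flywheel $i$), without self-loops and with no edge entering node $0$, each with a fixed weighted adjacency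 matrix (zero diagonal; entry $(i,j)$ positive if $(j,i)$ is an edge and zero otherwise). Let $\sigma:[0,\infty)\to\{1,\dots,n\}$ be constant on every $[t_k,t_{k+1})$, $k\ge 0$, where $t_0=0$ and $t_{k+1}-t_k\ge\tau$ for some $\tau>0$ and all $k$, and let $[a_{ij}(t)]$ be the adjacency matrix of $\bar{\mathcal G}_{\sigma(t)}$. For $i=1,\dots,N$ the control law is $$\dot S_i=\mu_S\sum_{j=0}^N a_{ij}(t)(S_j-S_i),\qquad \dot C_i=\mu_C\sum_{j=0}^N a_{ij}(t)(C_j-C_i),$$ $$\dot\eta_i=S_i\eta_i+\mu_\eta\sum_{j=0}^N a_{ij}(t)(\eta_j-\eta_i),\qquad \hat P_{i,REF}=C_i\eta_i,$$ $$\dot\alpha_i=\mu_\alpha\sum_{j=0}^N a_{ij}(t)(\alpha_j-\alpha_i),\qquad \dot\beta_i=\mu_\beta\sum_{j=0}^N a_{ij}(t)(\beta_j-\beta_i),$$ $$\dot\psi_i=-\alpha_i\psi_i-\beta_i\hat P_{i,REF}+\mu_\psi\sum_{j=0}^N a_{ij}(t)(\psi_j-\psi_i),$$ $$P_{i,out}=-\frac{I_i}{2\gamma_i}\Big(-\alpha_i\psi_i-\beta_i\hat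 P_{i,REF}-\kappa(\phi_i-\psi_i)+\frac{2B_{vi}}{I_i}\phi_i\Big),$$ where $S_i\in\mathbb R^{q\times q}$, $C_i\in\mathbb R^{1\times q}$, $\eta_i\in\mathbb R^q$, $\alpha_i,\beta_i,\psi_i\in\mathbb R$. **Theorem.** Assume that 1. (joint connectivity) there are a subsequence $j_0<j_1<j_2<\cdots$ of $0,1,2,\dots$ and $\epsilon>0$ such that for every $k$, $t_{j_{k+1}}-t_{j_k}<\epsilon$ and every node $i=1,\dots,N$ is reachable from node $0$ by a directed path in the union digraph $\bigcup_{r=j_k}^{j_{k+1}-1}\bar{\mathcal G}_{\sigma(t_r)}$; 2. no eigenvalue of $S_0$ has positive real part. Then for all gains $\mu_S,\mu_C,\mu_\eta,\mu_\alpha,\mu_\beta,\mu_\psi,\kappa>0$, every solution on $[0,\infty)$ of the closed-loop system (for any initial values) satisfies $$\lim_{t\to\infty}\big(P_{FESMS}(t)-P_{REF}(t)\big)=0,$$ and, for all $i,j\in\{1,\dots,N\}$ with $i\ne j$, $$\lim_{t\to\infty}\big(\phi_i(t)-\phi_j(t)\big)=0,\qquad \lim_{t\to\infty}\big(\dot\phi_i(t)-\dot\phi_j(t)\big)=0.$$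 -/

import Mathlib

namespace FESMS

open Set Filter Topology

/-! ### Flywheel systems and the command generator -/

/-- Physical parameters of `N` heterogeneous flywheels. -/
structure Flywheels (N : ℕ) where
  /-- inertia `I_i` -/
  inertia : Fin N → ℝ
  /-- friction coefficient `B_{vi}` -/
  friction : Fin N → ℝ
  /-- maximum admissible angular velocity `ω_{i,max}` -/
  omegaMax : Fin N → ℝ
  inertia_pos : ∀ i, 0 < inertia i
  friction_pos : ∀ i, 0 < friction i
  omegaMax_pos : ∀ i, 0 < omegaMax i

variable {N q n : ℕ}

/-- `γ_i = 1 / ω_{i,max}²`. -/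
noncomputable def Flywheels.gamma (F : Flywheels N) (i : Fin N) : ℝ :=
  1 / F.omegaMax i ^ 2

/-- `α₀ = 2 (∑ B_{vi} / γ_i) / (∑ I_i / γ_i)`. -/
noncomputable def Flywheels.alpha0 (F : Flywheels N) : ℝ :=
  (2 * ∑ i, F.friction i / F.gamma i) / ∑ i, F.inertia i / F.gamma i

/-- `β₀ = 2 / (∑ I_i / γ_i)`. -/
noncomputable def Flywheels.beta0 (F : Flywheels N) : ℝ :=
  2 / ∑ i, F.inertia i / F.gamma i

/-- No (complex) eigenvalue of the real matrix `A` has positive real part. -/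
def NoEigenvalueWithPosRe (A : Matrix (Fin q) (Fin q) ℝ) : Prop :=
  ∀ z : ℂ, Module.End.HasEigenvalue (Matrix.toLin' (A.map Complex.ofReal)) z → z.re ≤ 0

/-! ### Communication network: node `0` is the command generator, node `i.succ` is flywheel `i` -/

/-- `A` is a weighted adjacency matrix of `G`: `a_ii = 0`, `a_ij > 0 ↔ (j, i) ∈ E` and
`a_ij = 0 ↔ (j, i) ∉ E`, where `G.Adj j i` is the edge `(j, i)` from `j` to `i`. -/
structure IsWeightedAdjacency {V : Type*} (G : Digraph V) (A : Matrix V V ℝ) : Prop where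
  diag : ∀ i, A i i = 0
  pos_iff : ∀ i j, 0 < A i j ↔ G.Adj j i
  zero_iff : ∀ i j, A i j = 0 ↔ ¬ G.Adj j i

/-- A finite family of augmented digraphs on the nodes `0, 1, …, N`, in which no edge enters
node `0`, each with a weighted adjacency matrix. -/
structure Network (N n : ℕ) where
  graph : Fin n → Digraph (Fin (N + 1))
  no_edge_into_zero : ∀ p j, ¬ (graph p).Adj j 0
  weight : Fin n → Matrix (Fin (N + 1)) (Fin (N + 1)) ℝ
  isWeightedAdjacency : ∀ p, IsWeightedAdjacency (graph p) (weight p)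

/-- A piecewise constant switching signal on `[0, ∞)` with values in a set of `n` modes, with
switching instants `0 = t₀ < t₁ < …` and a positive dwell time. -/
structure SwitchingSignal (n : ℕ) where
  /-- the mode at time `s` (only `s ≥ 0` matters) -/
  mode : ℝ → Fin n
  /-- the switching instants -/
  instant : ℕ → ℝ
  instant_zero : instant 0 = 0
  dwell : ∃ τ : ℝ, 0 < τ ∧ ∀ k, τ ≤ instant (k + 1) - instant k
  mode_eq : ∀ k, ∀ s ∈ Ico (instant k) (instant (k + 1)), mode s = mode (instant k)

/-- There is a directed path from `u` to `v` in `G`. -/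
def Reachable {V : Type*} (G : Digraph V) (u v : V) : Prop :=
  Relation.TransGen G.Adj u v

/-- The union of the augmented digraphs active on the intervals starting at `t_a, …, t_{b-1}`. -/
def unionGraph (net : Network N n) (sig : SwitchingSignal n) (a b : ℕ) :
    Digraph (Fin (N + 1)) :=
  ⨆ r ∈ Finset.Ico a b, net.graph (sig.mode (sig.instant r))

/-- The switching digraph is jointly connected from node `0`. -/
def JointlyConnected (net : Network N n) (sig : SwitchingSignal n) : Prop :=
  ∃ j : ℕ → ℕ, StrictMono j ∧ ∃ ε : ℝ, 0 < ε ∧ ∀ k,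
    sig.instant (j (k + 1)) - sig.instant (j k) < ε ∧
    ∀ i : Fin N, Reachable (unionGraph net sig (j k) (j (k + 1))) 0 i.succ

/-- `a_ij(t)`. -/
def adj (net : Network N n) (sig : SwitchingSignal n) (t : ℝ) (i j : Fin (N + 1)) : ℝ :=
  net.weight (sig.mode t) i j

/-! ### Solutions of differential equations on `[0, ∞)` -/

/-- `x` satisfies `ẋ(t) = v(t)` on `[0, ∞)` (one-sided derivative at `0`). -/
def Solves {E : Type*} [NormedAddCommGroup E] [NormedSpace ℝ E] (x v : ℝ → E) : Prop :=
  ∀ t, 0 ≤ t → HasDerivWithinAt x (v t) (Ici 0) t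

/-- `x` satisfies `ẋ(t) = v(t)` on `[0, ∞)` where `v` may jump at the switching instants:
`x` is continuous, and `v` is its right derivative. (For a piecewise continuous,
right-continuous `v` this is the usual notion of a solution,
`x(t) = x(0) + ∫₀ᵗ v(s) ds`.) -/
def SolvesSwitched {E : Type*} [NormedAddCommGroup E] [NormedSpace ℝ E] (x v : ℝ → E) : Prop :=
  ContinuousOn x (Ici 0) ∧ ∀ t, 0 ≤ t → HasDerivWithinAt x (v t) (Ici t) t

/-! ### The closed loop -/

/-- The positive gains of the control law. -/
structure Gains where
  muS : ℝ
  muC : ℝ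
  muEta : ℝ
  muAlpha : ℝ
  muBeta : ℝ
  muPsi : ℝ
  kappa : ℝ
  muS_pos : 0 < muS
  muC_pos : 0 < muC
  muEta_pos : 0 < muEta
  muAlpha_pos : 0 < muAlpha
  muBeta_pos : 0 < muBeta
  muPsi_pos : 0 < muPsi
  kappa_pos : 0 < kappa

/-- The signals of the closed loop. Index `0` belongs to the (augmented) command generator, index
`i.succ` to the observer of flywheel `i`; `phi i` is the state of energy of flywheel `i`. The row
vectors `C_i ∈ ℝ^{1×q}` are represented as elements of `ℝ^q`. -/
structure Signals (N q : ℕ) where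
  S : Fin (N + 1) → ℝ → Matrix (Fin q) (Fin q) ℝ
  C : Fin (N + 1) → ℝ → (Fin q → ℝ)
  eta : Fin (N + 1) → ℝ → (Fin q → ℝ)
  alpha : Fin (N + 1) → ℝ → ℝ
  beta : Fin (N + 1) → ℝ → ℝ
  psi : Fin (N + 1) → ℝ → ℝ
  phi : Fin N → ℝ → ℝ

/-- `C_i η_i`: this is `P_REF` for `i = 0` and the estimate of `P_REF` by node `i` otherwise. -/
def Signals.pRef (x : Signals N q) (i : Fin (N + 1)) (t : ℝ) : ℝ :=
  x.C i t ⬝ᵥ x.eta i t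

/-- The control input `P_{i,out}` given by the local tracking control law. -/
noncomputable def Signals.pOut (x : Signals N q) (F : Flywheels N) (g : Gains)
    (i : Fin N) (t : ℝ) : ℝ :=
  -(F.inertia i / (2 * F.gamma i)) *
    (-x.alpha i.succ t * x.psi i.succ t - x.beta i.succ t * x.pRef i.succ t
      - g.kappa * (x.phi i t - x.psi i.succ t)
      + 2 * F.friction i / F.inertia i * x.phi i t)

/-- `P_FESMS = ∑ P_{i,out}`. -/
noncomputable def Signals.pFESMS (x : Signals N q) (F : Flywheels N) (g : Gains) (t : ℝ) : ℝ :=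
  ∑ i, x.pOut F g i t

/-- `x` is a trajectory on `[0, ∞)` of the augmented command generator, the flywheel systems and
the double-layer adaptive distributed observers, in closed loop. -/
structure IsClosedLoop (F : Flywheels N) (S₀ : Matrix (Fin q) (Fin q) ℝ) (C₀ : Fin q → ℝ)
    (net : Network N n) (sig : SwitchingSignal n) (g : Gains) (x : Signals N q) : Prop where
  S_zero : ∀ t, 0 ≤ t → x.S 0 t = S₀
  C_zero : ∀ t, 0 ≤ t → x.C 0 t = C₀
  alpha_zero : ∀ t, 0 ≤ t → x.alpha 0 t = F.alpha0
  beta_zero : ∀ t, 0 ≤ t → x.beta 0 t = F.beta0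
  eta_zero : Solves (x.eta 0) (fun t => S₀.mulVec (x.eta 0 t))
  psi_zero : Solves (x.psi 0) (fun t => -F.alpha0 * x.psi 0 t - F.beta0 * x.pRef 0 t)
  phi : ∀ i : Fin N, Solves (x.phi i) (fun t =>
    -(2 * F.friction i / F.inertia i) * x.phi i t
      - 2 * F.gamma i / F.inertia i * x.pOut F g i t)
  /- the matrix equation for `S_i`, entry by entry -/
  S : ∀ (i : Fin N) (a b : Fin q), SolvesSwitched (fun t => x.S i.succ t a b) (fun t =>
    g.muS * ∑ j, adj net sig t i.succ j * (x.S j t a b - x.S i.succ t a b))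
  C : ∀ i : Fin N, SolvesSwitched (x.C i.succ) (fun t =>
    g.muC • ∑ j, adj net sig t i.succ j • (x.C j t - x.C i.succ t))
  eta : ∀ i : Fin N, SolvesSwitched (x.eta i.succ) (fun t =>
    (x.S i.succ t).mulVec (x.eta i.succ t)
      + g.muEta • ∑ j, adj net sig t i.succ j • (x.eta j t - x.eta i.succ t))
  alpha : ∀ i : Fin N, SolvesSwitched (x.alpha i.succ) (fun t =>
    g.muAlpha * ∑ j, adj net sig t i.succ j * (x.alpha j t - x.alpha i.succ t))
  beta : ∀ i : Fin N, SolvesSwitched (x.beta i.succ) (fun t =>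
    g.muBeta * ∑ j, adj net sig t i.succ j * (x.beta j t - x.beta i.succ t))
  psi : ∀ i : Fin N, SolvesSwitched (x.psi i.succ) (fun t =>
    -x.alpha i.succ t * x.psi i.succ t - x.beta i.succ t * x.pRef i.succ t
      + g.muPsi * ∑ j, adj net sig t i.succ j * (x.psi j t - x.psi i.succ t))

/-- The dual control objective: power tracking and state-of-energy balancing. -/
structure DualObjective (pFESMS pREF : ℝ → ℝ) (phi : Fin N → ℝ → ℝ) : Prop where
  power : Tendsto (fun t => pFESMS t - pREF t) atTop (𝓝 0)
  balance : ∀ i j, i ≠ j → Tendsto (fun t => phi i t - phi j t) atTop (𝓝 0)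
  balance_deriv : ∀ i j, i ≠ j →
    Tendsto (fun t => deriv (phi i) t - deriv (phi j) t) atTop (𝓝 0)

end FESMS

/-! ### Dini derivatives, the maximum principle, and propagation of gaps below the maximum -/

namespace FESMS

open Set Filter Topology

/-! Each observer signal is compared with the leader signal it estimates. The error vanishes at the
leader and obeys a consensus equation with a linear drift (zero, `S₀` or `-α₀`), a multiplicative
perturbation that tends to zero, and an exponentially decaying forcing. By `expDecay_of_consensus`
such errors decay exponentially. This is applied in cascade: to S, C, α, β with no forcing, then to
η and ψ, whose perturbations come from the errors already controlled. The leader signals may be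
unbounded, since `S₀` may have Jordan blocks on the imaginary axis, but they grow slower than every
exponential, so their products with decaying errors still decay.

Two facts carry the consensus estimate. First, for scalar functions obeying the consensus inequality
the maximum M over the nodes cannot increase. A node with a gap below M keeps part of it over a
window, and passes part of it on along an edge active for the dwell time. Joint connectivity
supplies in each window an edge leaving the set of nodes that already have a gap, so N windows
contract M by a uniform factor (`exists_contraction`), and a small exponential growth rate is
tolerated (`exists_growth_bounded`). Second, since the drift has no unstable eigenvalue, for each ε
some equivalent norm expands at rate at most ε along its flow (`quasiDissipative_mulVecLin`). By
convexity that norm of the error satisfies the scalar inequality; it need not be differentiable,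
hence the Dini derivatives. Weighting it by a slowly growing exponential turns boundedness into
decay.

Finally the control law cancels friction, so each state of energy follows the leader's ψ together
with its derivative, and `α₀`, `β₀` are exactly the values for which the outputs along ψ add up to
the reference power. -/

/-- The upper right Dini derivative of `f` at `t` is at most `d`. -/
def RightDiniLE (f : ℝ → ℝ) (t d : ℝ) : Prop :=
  ∀ r, d < r → ∀ᶠ y in 𝓝[>] t, slope f t y < r

theorem RightDiniLE.mono {f : ℝ → ℝ} {t d d' : ℝ} (h : RightDiniLE f t d) (hd : d ≤ d') :
    RightDiniLE f t d' := fun r hr => h r (hd.trans_lt hr)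

theorem rightDiniLE_of_hasDerivWithinAt {f : ℝ → ℝ} {t d : ℝ}
    (h : HasDerivWithinAt f d (Ici t) t) : RightDiniLE f t d := by
  intro r hr
  have h1 := (hasDerivWithinAt_iff_tendsto_slope' (self_notMem_Ioi (a := t))).1
    (h.mono Ioi_subset_Ici_self)
  exact h1.eventually_lt_const hr

theorem RightDiniLE.add {f g : ℝ → ℝ} {t d e : ℝ} (hf : RightDiniLE f t d)
    (hg : RightDiniLE g t e) : RightDiniLE (fun s => f s + g s) t (d + e) := by
  intro r hr
  have h1 : d < d + (r - d - e) / 2 := by linarith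
  have h2 : e < e + (r - d - e) / 2 := by linarith
  filter_upwards [hf _ h1, hg _ h2] with y hy1 hy2
  have : slope (fun s => f s + g s) t y = slope f t y + slope g t y := by
    simp only [slope_def_field]; ring
  rw [this]; linarith

/-- Product rule for the Dini derivative, with a differentiable positive factor. -/
theorem RightDiniLE.mul_left {f g : ℝ → ℝ} {t d g' : ℝ} (hf : RightDiniLE f t d)
    (hg : HasDerivWithinAt g g' (Ici t) t) (hpos : 0 < g t) :
    RightDiniLE (fun s => g s * f s) t (g' * f t + g t * d) := by
  intro r hr
  have h1 := (hasDerivWithinAt_iff_tendsto_slope' (self_notMem_Ioi (a := t))).1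
    (hg.mono Ioi_subset_Ici_self)
  have h2 : Tendsto g (𝓝[>] t) (𝓝 (g t)) :=
    (hg.continuousWithinAt.mono Ioi_subset_Ici_self).tendsto
  obtain ⟨d', hd', hr'⟩ : ∃ d', d < d' ∧ g' * f t + g t * d' < r := by
    refine ⟨d + (r - (g' * f t + g t * d)) / (2 * g t), ?_, ?_⟩
    · have : 0 < (r - (g' * f t + g t * d)) / (2 * g t) := by
        apply div_pos <;> linarith
      linarith
    · have : g t * (d + (r - (g' * f t + g t * d)) / (2 * g t))
          = g t * d + (r - (g' * f t + g t * d)) / 2 := by field_simp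
      rw [this]; linarith
  have h3 : Tendsto (fun y => slope g t y * f t + g y * d') (𝓝[>] t)
      (𝓝 (g' * f t + g t * d')) := (h1.mul_const _).add (h2.mul_const _)
  filter_upwards [hf _ hd', h3.eventually_lt_const hr', h2.eventually_const_lt hpos] with y a b c
  have : slope (fun s => g s * f s) t y = slope g t y * f t + g y * slope f t y := by
    simp only [slope_def_field]; ring
  rw [this]
  have := mul_lt_mul_of_pos_left a c
  linarith

/-- Comparison principle. -/
theorem le_of_rightDiniLE {f f' B B' : ℝ → ℝ} {a b : ℝ} (hf : ContinuousOn f (Icc a b))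
    (hf' : ∀ x ∈ Ico a b, RightDiniLE f x (f' x)) (ha : f a ≤ B a)
    (hB : ∀ x, HasDerivAt B (B' x) x)
    (bound : ∀ x ∈ Ico a b, f x = B x → f' x < B' x) : ∀ x ∈ Icc a b, f x ≤ B x := by
  intro x hx
  exact image_le_of_liminf_slope_right_lt_deriv_boundary hf
    (fun x hx r hr => (hf' x hx r hr).frequently) ha hB bound hx

/-- Maximum principle for a cooperative system of differential inequalities. -/
theorem le_of_consensus_inequality {ι : Type*} [Fintype ι] {U : ι → ℝ → ℝ} {w : ℝ → ι → ι → ℝ}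
    {a b M : ℝ} (hw : ∀ t ∈ Ico a b, ∀ i j, 0 ≤ w t i j)
    (hc : ∀ i, ContinuousOn (U i) (Icc a b))
    (hd : ∀ i, ∀ t ∈ Ico a b, RightDiniLE (U i) t (∑ j, w t i j * (U j t - U i t)))
    (ha : ∀ i, U i a ≤ M) (i : ι) : ∀ t ∈ Icc a b, U i t ≤ M := by
  classical
  have hne : (Finset.univ : Finset ι).Nonempty := ⟨i, Finset.mem_univ i⟩
  have key : ∀ t ∈ Icc a b, Finset.univ.sup' hne (fun i => U i t) ≤ M := by
    intro t ht
    refine image_le_of_liminf_slope_right_le_deriv_boundary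
      (f := fun t => Finset.univ.sup' hne (fun i => U i t)) (B := fun _ => M) (B' := fun _ => 0)
      ?_ ?_ continuousOn_const (fun x _ => hasDerivWithinAt_const _ _ _) ?_ ht
    · exact ContinuousOn.finset_sup'_apply hne (fun i _ => hc i)
    · exact Finset.sup'_le _ _ (fun i _ => ha i)
    · intro x hx r hr
      apply Eventually.frequently
      have hall : ∀ᶠ y in 𝓝[>] x, ∀ i,
          U i y < Finset.univ.sup' hne (fun i => U i x) + r * (y - x) := by
        rw [eventually_all]
        intro i
        have hle : U i x ≤ Finset.univ.sup' hne (fun i => U i x) :=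
          Finset.le_sup' (fun i => U i x) (Finset.mem_univ i)
        -- A node strictly below the maximum stays below it for a short time by continuity; at a
        -- node attaining it every consensus term is nonpositive.
        rcases hle.lt_or_eq with hlt | heq
        · have h1 : Tendsto (U i) (𝓝[>] x) (𝓝 (U i x)) := by
            have : ContinuousWithinAt (U i) (Icc x b) x :=
              (hc i x ⟨hx.1, hx.2.le⟩).mono (Icc_subset_Icc_left hx.1)
            rw [ContinuousWithinAt, nhdsWithin_Icc_eq_nhdsGE hx.2] at this
            exact this.mono_left (nhdsWithin_mono _ Ioi_subset_Ici_self)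
          filter_upwards [h1.eventually_lt_const hlt, self_mem_nhdsWithin] with y hy hy'
          have : 0 < r * (y - x) := mul_pos hr (sub_pos.2 hy')
          linarith
        · have hs : ∑ j, w x i j * (U j x - U i x) ≤ 0 := by
            apply Finset.sum_nonpos
            intro j _
            apply mul_nonpos_of_nonneg_of_nonpos (hw x hx i j)
            have : U j x ≤ Finset.univ.sup' hne (fun i => U i x) :=
              Finset.le_sup' (fun i => U i x) (Finset.mem_univ j)
            linarith
          filter_upwards [hd i x hx r (hs.trans_lt hr), self_mem_nhdsWithin] with y hy hy'
          rw [slope_def_field, div_lt_iff₀ (sub_pos.2 hy')] at hy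
          linarith
      filter_upwards [hall, self_mem_nhdsWithin] with y hy hy'
      rw [slope_def_field, div_lt_iff₀ (sub_pos.2 hy')]
      have : Finset.univ.sup' hne (fun i => U i y)
          < Finset.univ.sup' hne (fun i => U i x) + r * (y - x) := by
        rw [Finset.sup'_lt_iff]; exact fun i _ => hy i
      linarith
  intro t ht
  exact (Finset.le_sup' (fun i => U i t) (Finset.mem_univ i)).trans (key t ht)

/-- A gap below the upper bound `M` decays at most exponentially. -/
theorem gap_persists {u d : ℝ → ℝ} {a b M D c : ℝ} (hu : ContinuousOn u (Icc a b))
    (hd : ∀ t ∈ Ico a b, RightDiniLE u t (d t))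
    (hD : ∀ t ∈ Ico a b, d t ≤ D * (M - u t)) (hc : 0 < c) (ha : u a ≤ M - c) :
    ∀ t ∈ Icc a b, u t ≤ M - c * Real.exp (-(D + 1) * (t - a)) := by
  -- The rate is D + 1 rather than D because the comparison principle needs a strict inequality at
  -- contact.
  refine le_of_rightDiniLE (B' := fun t => c * (D + 1) * Real.exp (-(D + 1) * (t - a)))
    hu hd (by simpa using ha) ?_ ?_
  · intro x
    have h1 : HasDerivAt (fun t : ℝ => -(D + 1) * (t - a)) (-(D + 1) * 1) x :=
      ((hasDerivAt_id x).sub_const a).const_mul _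
    exact ((h1.exp.const_mul c).const_sub M).congr_deriv (by ring)
  · intro x hx hux
    have h1 := hD x hx
    rw [hux] at h1
    have := mul_pos hc (Real.exp_pos (-(D + 1) * (x - a)))
    nlinarith

/-- A link of weight at least `w` to a node with gap `c`, active for a time `τ`, creates a gap. -/
theorem gap_created {u d : ℝ → ℝ} {a τ M D c w : ℝ} (hτ : 0 < τ) (hD0 : 0 ≤ D) (hw : 0 < w)
    (hu : ContinuousOn u (Icc a (a + τ))) (hd : ∀ t ∈ Ico a (a + τ), RightDiniLE u t (d t))
    (hD : ∀ t ∈ Ico a (a + τ), d t ≤ D * (M - u t) - w * c) (hc : 0 < c) (ha : u a ≤ M) :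
    u (a + τ) ≤ M - w * τ / (2 * (1 + D * τ)) * c := by
  have h1 : 0 < 1 + D * τ := by positivity
  -- Linear barrier of slope -k with w c = 2k(1 + Dτ): at contact the derivative is at most Dkτ -
  -- 2k(1 + Dτ) < -k.
  have := le_of_rightDiniLE (B := fun t => M - w * c / (2 * (1 + D * τ)) * (t - a))
    (B' := fun t => - (w * c / (2 * (1 + D * τ)))) hu hd (by simpa using ha) ?_ ?_ (a + τ)
    ⟨by linarith, le_rfl⟩
  · refine this.trans (le_of_eq ?_)
    field_simp
    ring
  · intro x
    exact ((((hasDerivAt_id x).sub_const a).const_mul (w * c / (2 * (1 + D * τ)))).const_sub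
      M).congr_deriv (by ring)
  · intro x hx hux
    refine (hD x hx).trans_lt ?_
    rw [hux]
    set k := w * c / (2 * (1 + D * τ)) with hk
    have hkpos : 0 < k := by positivity
    have hwc : w * c = k * (2 * (1 + D * τ)) := by rw [hk]; field_simp
    have hx' : x - a ≤ τ := by linarith [hx.2]
    have h2 : D * (k * (x - a)) ≤ D * (k * τ) := by gcongr
    rw [hwc]
    nlinarith

/-- The factor by which the gap below the maximum shrinks when it is passed on to a new node. -/
noncomputable def gapFactor (D w τ ε : ℝ) : ℝ :=
  Real.exp (-(D + 1) * ε) * Real.exp (-(D + 1) * ε) * min 1 (w * τ / (2 * (1 + D * τ)))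

theorem gapFactor_pos {D w τ : ℝ} (ε : ℝ) (hD : 0 ≤ D) (hw : 0 < w) (hτ : 0 < τ) :
    0 < gapFactor D w τ ε := by
  unfold gapFactor; positivity

/-- Lets one factor serve both the nodes that merely keep their gap and those that acquire one. The
two exponentials in `gapFactor` account for the source's loss before the link acts and the
receiver's loss after it. -/
theorem gapFactor_le {D w τ ε : ℝ} (hD : 0 ≤ D) (hw : 0 < w) (hτ : 0 < τ) (hε : 0 ≤ ε) :
    gapFactor D w τ ε ≤ Real.exp (-(D + 1) * ε) := by
  unfold gapFactor
  have h1 : Real.exp (-(D + 1) * ε) ≤ 1 := Real.exp_le_one_iff.2 (by nlinarith)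
  have h2 : min 1 (w * τ / (2 * (1 + D * τ))) ≤ 1 := min_le_left _ _
  have h3 : 0 ≤ min 1 (w * τ / (2 * (1 + D * τ))) := by positivity
  calc _ ≤ Real.exp (-(D + 1) * ε) * 1 * 1 := by gcongr
    _ = _ := by ring

section Window

variable {ι : Type*} [Fintype ι] {U : ι → ℝ → ℝ} {w : ℝ → ι → ι → ℝ} {a b M D ε c : ℝ}

theorem consensus_rate_le (hw : ∀ t ∈ Ico a b, ∀ i j, 0 ≤ w t i j)
    (hD : ∀ t ∈ Ico a b, ∀ i, ∑ j, w t i j ≤ D)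
    (hM : ∀ i, ∀ t ∈ Icc a b, U i t ≤ M) (i : ι) (t : ℝ) (ht : t ∈ Ico a b) :
    ∑ j, w t i j * (U j t - U i t) ≤ D * (M - U i t) := by
  have ht' : t ∈ Icc a b := ⟨ht.1, ht.2.le⟩
  calc ∑ j, w t i j * (U j t - U i t) ≤ ∑ j, w t i j * (M - U i t) := by
        gcongr with j _
        · exact hw t ht i j
        · exact hM j t ht'
    _ = (∑ j, w t i j) * (M - U i t) := by rw [Finset.sum_mul]
    _ ≤ D * (M - U i t) := by
        gcongr
        · linarith [hM i t ht']
        · exact hD t ht i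

/-- Over a window of length at most `ε`, gaps survive up to a constant factor. -/
theorem gap_persists_window (hD0 : 0 ≤ D) (hba : b - a ≤ ε)
    (hw : ∀ t ∈ Ico a b, ∀ i j, 0 ≤ w t i j)
    (hD : ∀ t ∈ Ico a b, ∀ i, ∑ j, w t i j ≤ D)
    (hc : ∀ i, ContinuousOn (U i) (Icc a b))
    (hd : ∀ i, ∀ t ∈ Ico a b, RightDiniLE (U i) t (∑ j, w t i j * (U j t - U i t)))
    (hM : ∀ i, ∀ t ∈ Icc a b, U i t ≤ M) (hc0 : 0 < c) (i : ι) (hi : U i a ≤ M - c) :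
    ∀ t ∈ Icc a b, U i t ≤ M - Real.exp (-(D + 1) * ε) * c := by
  intro t ht
  refine (gap_persists (hc i) (hd i) (consensus_rate_le hw hD hM i) hc0 hi t ht).trans ?_
  have : Real.exp (-(D + 1) * ε) ≤ Real.exp (-(D + 1) * (t - a)) := by
    apply Real.exp_le_exp.2
    have := ht.2
    nlinarith
  nlinarith

/-- A node linked for a time `τ` to a node with a gap acquires a gap in the window. -/
theorem gap_spreads_window {τ w₀ s : ℝ} (hτ : 0 < τ) (hw0 : 0 < w₀) (hD0 : 0 ≤ D)
    (hba : b - a ≤ ε)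
    (hw : ∀ t ∈ Ico a b, ∀ i j, 0 ≤ w t i j)
    (hD : ∀ t ∈ Ico a b, ∀ i, ∑ j, w t i j ≤ D)
    (hc : ∀ i, ContinuousOn (U i) (Icc a b))
    (hd : ∀ i, ∀ t ∈ Ico a b, RightDiniLE (U i) t (∑ j, w t i j * (U j t - U i t)))
    (hM : ∀ i, ∀ t ∈ Icc a b, U i t ≤ M) (hc0 : 0 < c) (i j : ι) (hj : U j a ≤ M - c)
    (has : a ≤ s) (hsb : s + τ ≤ b) (hij : ∀ t ∈ Ico s (s + τ), w₀ ≤ w t i j) :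
    U i b ≤ M - gapFactor D w₀ τ ε * c := by
  classical
  set E := Real.exp (-(D + 1) * ε) with hE
  have hEpos : 0 < E := Real.exp_pos _
  have hj' := gap_persists_window hD0 hba hw hD hc hd hM hc0 j hj
  have hsub : Icc s (s + τ) ⊆ Icc a b := Icc_subset_Icc has hsb
  have hsub' : Ico s (s + τ) ⊆ Ico a b := Ico_subset_Ico has hsb
  have hcreate : U i (s + τ) ≤ M - w₀ * τ / (2 * (1 + D * τ)) * (E * c) := by
    refine gap_created hτ hD0 hw0 ((hc i).mono hsub) (fun t ht => hd i t (hsub' ht)) ?_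
      (mul_pos hEpos hc0) (hM i s (hsub ⟨le_rfl, by linarith⟩))
    intro t ht
    have ht1 := hsub' ht
    have ht2 : t ∈ Icc a b := ⟨ht1.1, ht1.2.le⟩
    -- Every neighbour pulls up by at most its weight times M - U i; the neighbour j, having kept
    -- the gap E c, pulls by at least w₀ E c less.
    have h1 : ∀ k, w t i k * (U k t - U i t)
        ≤ w t i k * (M - U i t) - if k = j then w₀ * (E * c) else 0 := by
      intro k
      split_ifs with hk
      · subst hk
        have := hj' t ht2
        have h3 : w t i k * (U k t - U i t) ≤ w t i k * (M - E * c - U i t) := by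
          gcongr
          exact hw t ht1 i k
        have h4 : w₀ * (E * c) ≤ w t i k * (E * c) := by
          gcongr
          exact hij t ht
        linarith
      · rw [sub_zero]
        gcongr
        · exact hw t ht1 i k
        · exact hM k t ht2
    calc ∑ k, w t i k * (U k t - U i t)
        ≤ ∑ k, (w t i k * (M - U i t) - if k = j then w₀ * (E * c) else 0) :=
          Finset.sum_le_sum fun k _ => h1 k
      _ = (∑ k, w t i k) * (M - U i t) - w₀ * (E * c) := by
          rw [Finset.sum_sub_distrib, Finset.sum_mul]; simp
      _ ≤ D * (M - U i t) - w₀ * (E * c) := by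
          gcongr
          · linarith [hM i t ht2]
          · exact hD t ht1 i
  have hm : 0 < min 1 (w₀ * τ / (2 * (1 + D * τ))) := by positivity
  have hcreate' : U i (s + τ) ≤ M - min 1 (w₀ * τ / (2 * (1 + D * τ))) * (E * c) := by
    refine hcreate.trans ?_
    gcongr
    exact min_le_right _ _
  have hab : a ≤ s + τ := by linarith
  have hsub2 : Icc (s + τ) b ⊆ Icc a b := Icc_subset_Icc_left hab
  have hsub2' : Ico (s + τ) b ⊆ Ico a b := Ico_subset_Ico_left hab
  have := gap_persists_window (a := s + τ) (b := b) (ε := ε) hD0 (by linarith)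
    (fun t ht => hw t (hsub2' ht)) (fun t ht => hD t (hsub2' ht))
    (fun i => (hc i).mono hsub2) (fun i t ht => hd i t (hsub2' ht))
    (fun i t ht => hM i t (hsub2 ht)) (mul_pos hm (mul_pos hEpos hc0)) i hcreate' b ⟨hsb, le_rfl⟩
  refine this.trans (le_of_eq ?_)
  simp only [gapFactor, ← hE]
  ring

end Window

end FESMS

/-! ### Contraction under joint connectivity and boundedness of slowly growing consensus systems -/

namespace FESMS

open Set Filter Topology

variable {N q n : ℕ}

theorem SwitchingSignal.add_mul_le {sig : SwitchingSignal n} {τ : ℝ}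
    (hτ : ∀ k, τ ≤ sig.instant (k + 1) - sig.instant k) (k m : ℕ) :
    sig.instant k + m * τ ≤ sig.instant (k + m) := by
  induction m with
  | zero => simp
  | succ m ih =>
    have := hτ (k + m)
    push_cast
    rw [← add_assoc]
    linarith

theorem SwitchingSignal.instant_mono (sig : SwitchingSignal n) : Monotone sig.instant := by
  obtain ⟨τ, h0, hτ⟩ := sig.dwell
  exact monotone_nat_of_le_succ fun k => by linarith [hτ k]

theorem Network.weight_nonneg (net : Network N n) (p : Fin n) (i j : Fin (N + 1)) :
    0 ≤ net.weight p i j := by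
  by_cases h : (net.graph p).Adj j i
  · exact (((net.isWeightedAdjacency p).pos_iff i j).2 h).le
  · exact (((net.isWeightedAdjacency p).zero_iff i j).2 h).ge

theorem adj_nonneg (net : Network N n) (sig : SwitchingSignal n) (t : ℝ) (i j : Fin (N + 1)) :
    0 ≤ adj net sig t i j := net.weight_nonneg _ _ _

theorem adj_zero (net : Network N n) (sig : SwitchingSignal n) (t : ℝ) (j : Fin (N + 1)) :
    adj net sig t 0 j = 0 :=
  ((net.isWeightedAdjacency _).zero_iff 0 j).2 (net.no_edge_into_zero _ j)

/-- A positive lower bound for the weights of all edges. -/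
theorem Network.exists_weight_ge (net : Network N n) :
    ∃ w : ℝ, 0 < w ∧ ∀ p i j, (net.graph p).Adj j i → w ≤ net.weight p i j := by
  classical
  have h : ∀ x : Fin n × Fin (N + 1) × Fin (N + 1),
      ∀ᶠ w in 𝓝[>] (0 : ℝ), (net.graph x.1).Adj x.2.2 x.2.1 → w ≤ net.weight x.1 x.2.1 x.2.2 := by
    intro x
    by_cases hx : (net.graph x.1).Adj x.2.2 x.2.1
    · have := ((net.isWeightedAdjacency x.1).pos_iff x.2.1 x.2.2).2 hx
      filter_upwards [Ioo_mem_nhdsGT this] with w hw _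
      exact hw.2.le
    · exact Eventually.of_forall fun _ h => absurd h hx
  obtain ⟨w, hw, hw0⟩ := ((eventually_all.2 h).and self_mem_nhdsWithin).exists
  exact ⟨w, hw0, fun p i j hp => hw (p, i, j) hp⟩

theorem Network.exists_sum_weight_le (net : Network N n) :
    ∃ D : ℝ, 0 ≤ D ∧ ∀ p i, ∑ j, net.weight p i j ≤ D := by
  have hnn : ∀ p i, 0 ≤ ∑ j, net.weight p i j := fun p i =>
    Finset.sum_nonneg fun j _ => net.weight_nonneg p i j
  refine ⟨∑ p, ∑ i, ∑ j, net.weight p i j,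
    Finset.sum_nonneg fun p _ => Finset.sum_nonneg fun i _ => hnn p i, fun p i => ?_⟩
  exact (Finset.single_le_sum (f := fun i => ∑ j, net.weight p i j)
    (fun i _ => hnn p i) (Finset.mem_univ i)).trans
    (Finset.single_le_sum (f := fun p => ∑ i, ∑ j, net.weight p i j)
      (fun p _ => Finset.sum_nonneg fun i _ => hnn p i) (Finset.mem_univ p))

theorem exists_crossing_edge {V : Type*} {r : V → V → Prop} {R : Set V} {a b : V}
    (h : Relation.TransGen r a b) (ha : a ∈ R) (hb : b ∉ R) :
    ∃ x ∈ R, ∃ y ∉ R, r x y := by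
  induction h with
  | single h => exact ⟨a, ha, _, hb, h⟩
  | @tail c d _ hcd ih =>
    by_cases hc : c ∈ R
    · exact ⟨c, hc, d, hb, hcd⟩
    · exact ih hc

/-- `N` consecutive windows of joint connectivity contract a consensus system towards the
leader by a fixed factor. -/
theorem exists_contraction (net : Network N n) (sig : SwitchingSignal n)
    {j : ℕ → ℕ} {ε : ℝ} (hjm : StrictMono j) (hε : 0 < ε)
    (hj : ∀ k, sig.instant (j (k + 1)) - sig.instant (j k) < ε ∧
      ∀ i : Fin N, Reachable (unionGraph net sig (j k) (j (k + 1))) 0 i.succ)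
    {μ : ℝ} (hμ : 0 < μ) :
    ∃ δ : ℝ, 0 < δ ∧ δ < 1 ∧ ∀ (k : ℕ) (U : Fin (N + 1) → ℝ → ℝ) (M : ℝ), 0 < M →
      (∀ i, ContinuousOn (U i) (Icc (sig.instant (j k)) (sig.instant (j (k + N))))) →
      (∀ i, ∀ t ∈ Ico (sig.instant (j k)) (sig.instant (j (k + N))),
        RightDiniLE (U i) t (∑ l, μ * adj net sig t i l * (U l t - U i t))) →
      U 0 (sig.instant (j k)) ≤ 0 → (∀ i, U i (sig.instant (j k)) ≤ M) →
      ∀ i, U i (sig.instant (j (k + N))) ≤ (1 - δ) * M := by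
  classical
  obtain ⟨τ, hτ, hdw⟩ := sig.dwell
  obtain ⟨w₀, hw0, hw₀⟩ := net.exists_weight_ge
  obtain ⟨D, hD0, hD⟩ := net.exists_sum_weight_le
  have hμD : 0 ≤ μ * D := by positivity
  have hμw : 0 < μ * w₀ := by positivity
  set κ := gapFactor (μ * D) (μ * w₀) τ ε with hκ
  have hκ0 : 0 < κ := gapFactor_pos ε hμD hμw hτ
  have hκE := gapFactor_le hμD hμw hτ hε.le
  have hκ1 : κ < 1 := hκE.trans_lt (Real.exp_lt_one_iff.2 (by nlinarith))
  -- The halving keeps δ < 1 even for N = 0, where κ ^ N = 1.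
  refine ⟨κ ^ N / 2, by positivity, ?_, ?_⟩
  · have : κ ^ N ≤ 1 := pow_le_one₀ hκ0.le hκ1.le
    linarith
  intro k U M hM0 hc hd hU0 hUM
  set T := fun m => sig.instant (j m) with hT
  have hTm : Monotone T := sig.instant_mono.comp hjm.monotone
  have hnn : ∀ t i l, 0 ≤ μ * adj net sig t i l := fun t i l =>
    mul_nonneg hμ.le (adj_nonneg net sig t i l)
  have hsum : ∀ t i, ∑ l, μ * adj net sig t i l ≤ μ * D := by
    intro t i
    rw [← Finset.mul_sum]
    exact mul_le_mul_of_nonneg_left (hD _ i) hμ.le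
  have hM : ∀ i, ∀ t ∈ Icc (T k) (T (k + N)), U i t ≤ M := fun i =>
    le_of_consensus_inequality (w := fun t i l => μ * adj net sig t i l)
      (fun t _ i l => hnn t i l) hc hd hUM i
  -- R collects nodes with gap κ ^ m M after m windows. It starts as the leader alone and gains a
  -- node per window until it is everything, so N windows reach all N + 1 nodes.
  have key : ∀ m, m ≤ N → ∃ R : Finset (Fin (N + 1)), 0 ∈ R ∧ m + 1 ≤ R.card ∧
      ∀ i ∈ R, U i (T (k + m)) ≤ M - κ ^ m * M := by
    intro m
    induction m with
    | zero =>
      intro _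
      refine ⟨{0}, by simp, by simp, ?_⟩
      intro i hi
      rw [Finset.mem_singleton] at hi
      subst hi
      simpa using hU0
    | succ m ih =>
      intro hm
      obtain ⟨R, h0, hcard, hR⟩ := ih (by omega)
      have ha : T k ≤ T (k + m) := hTm (by omega)
      have hb : T (k + (m + 1)) ≤ T (k + N) := hTm (by omega)
      have hsub : Icc (T (k + m)) (T (k + (m + 1))) ⊆ Icc (T k) (T (k + N)) := Icc_subset_Icc ha hb
      have hsub' : Ico (T (k + m)) (T (k + (m + 1))) ⊆ Ico (T k) (T (k + N)) := Ico_subset_Ico ha hb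
      have hlen : T (k + (m + 1)) - T (k + m) ≤ ε := (hj (k + m)).1.le
      have hc' := fun i => (hc i).mono hsub
      have hd' := fun i t ht => hd i t (hsub' ht)
      have hM' := fun i t ht => hM i t (hsub ht)
      have hcm : 0 < κ ^ m * M := by positivity
      have hab : T (k + m) ≤ T (k + (m + 1)) := hTm (by omega)
      have hpers : ∀ i ∈ R, U i (T (k + (m + 1))) ≤ M - κ ^ (m + 1) * M := by
        intro i hi
        refine (gap_persists_window hμD hlen (fun t _ i l => hnn t i l) (fun t _ i => hsum t i)
          hc' hd' hM' hcm i (hR i hi) _ ⟨hab, le_rfl⟩).trans ?_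
        have : κ * (κ ^ m * M) ≤ Real.exp (-(μ * D + 1) * ε) * (κ ^ m * M) := by gcongr
        have e : κ ^ (m + 1) * M = κ * (κ ^ m * M) := by ring
        linarith
      by_cases hfull : ∀ i, i ∈ R
      · refine ⟨R, h0, ?_, hpers⟩
        have : R = Finset.univ := Finset.eq_univ_iff_forall.2 hfull
        rw [this, Finset.card_univ, Fintype.card_fin]
        omega
      · push Not at hfull
        obtain ⟨v, hv⟩ := hfull
        obtain ⟨v', rfl⟩ : ∃ v' : Fin N, v = v'.succ :=
          Fin.exists_succ_eq.2 (fun h => hv (by rw [h]; exact h0)) |>.imp fun _ h => h.symm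
        -- A path from the leader to a node outside R must leave R. The crossing edge is active on a
        -- whole switching interval inside the window, hence for at least τ.
        obtain ⟨x, hx, y, hy, hxy⟩ := exists_crossing_edge (R := (R : Set (Fin (N + 1))))
          ((hj (k + m)).2 v') (by simpa using h0) (by simpa using hv)
        simp only [Finset.mem_coe] at hx hy
        simp only [unionGraph, Digraph.iSup_adj] at hxy
        obtain ⟨r, hr, hadj⟩ := hxy
        rw [Finset.mem_Ico] at hr
        refine ⟨insert y R, by simp [h0], ?_, ?_⟩
        · rw [Finset.card_insert_of_notMem hy]; omega
        · intro i hi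
          rcases Finset.mem_insert.1 hi with rfl | hi
          · have e : κ ^ (m + 1) * M = κ * (κ ^ m * M) := by ring
            rw [e]
            have hr1 : sig.instant (r + 1) ≤ T (k + (m + 1)) := sig.instant_mono hr.2
            refine gap_spreads_window (s := sig.instant r) hτ hμw hμD hlen
              (fun t _ i l => hnn t i l) (fun t _ i => hsum t i)
              hc' hd' hM' hcm i x (hR x hx) (sig.instant_mono hr.1)
              (by linarith [hdw r]) ?_
            intro t ht
            have hmode := sig.mode_eq r t ⟨ht.1, by linarith [ht.2, hdw r]⟩
            simp only [adj, hmode]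
            exact mul_le_mul_of_nonneg_left (hw₀ _ _ _ hadj) hμ.le
          · exact hpers i hi
  obtain ⟨R, -, hcard, hR⟩ := key N le_rfl
  have hRu : R = Finset.univ := by
    rw [← Finset.card_eq_iff_eq_univ, Fintype.card_fin]
    refine le_antisymm ?_ hcard
    simpa using Finset.card_le_univ R
  intro i
  refine (hR i (by simp [hRu])).trans ?_
  have : 0 < κ ^ N * M := by positivity
  nlinarith

/-- Solutions of a leader-following consensus inequality with a small growth rate and a bounded
forcing term are bounded. -/
theorem exists_growth_bounded (net : Network N n) (sig : SwitchingSignal n)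
    (hconn : JointlyConnected net sig) {μ : ℝ} (hμ : 0 < μ) :
    ∃ ε₀ : ℝ, 0 < ε₀ ∧ ∀ (W : Fin (N + 1) → ℝ → ℝ) (c t₀ : ℝ), 0 ≤ t₀ → 0 ≤ c →
      (∀ i, ContinuousOn (W i) (Ici 0)) → (∀ t, 0 ≤ t → W 0 t = 0) →
      (∀ i, ∀ t, t₀ ≤ t → RightDiniLE (W i) t
        (ε₀ * W i t + ∑ l, μ * adj net sig t i l * (W l t - W i t) + c)) →
      ∃ K, ∀ i, ∀ t, t₀ ≤ t → W i t ≤ K := by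
  obtain ⟨j, hjm, ε, hε, hj⟩ := hconn
  obtain ⟨δ, hδ0, hδ1, hδ⟩ := exists_contraction net sig hjm hε hj hμ
  obtain ⟨τ, hτ, hdw⟩ := sig.dwell
  set T := fun m => sig.instant (j m) with hT
  have hTm : Monotone T := sig.instant_mono.comp hjm.monotone
  have hTlen : ∀ k m, T (k + m) - T k ≤ m * ε := by
    intro k m
    induction m with
    | zero => simp
    | succ m ih =>
      have := (hj (k + m)).1
      have e : T (k + (m + 1)) - T (k + m) < ε := this
      push_cast
      linarith
  have hTtop : Tendsto T atTop atTop := by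
    refine tendsto_atTop_mono (f := fun m : ℕ => (m : ℝ) * τ) ?_
      (tendsto_natCast_atTop_atTop.atTop_mul_const hτ)
    intro m
    have h1 := SwitchingSignal.add_mul_le hdw 0 (j m)
    rw [sig.instant_zero, zero_add, zero_add] at h1
    have h2 : (m : ℝ) ≤ (j m : ℝ) := by exact_mod_cast hjm.le_apply
    have : (m : ℝ) * τ ≤ j m * τ := by gcongr
    simp only [hT]
    linarith
  set L : ℝ := N * ε with hL
  have hL0 : 0 ≤ L := by positivity
  -- L bounds the length of a block of N windows; the growth over one block must not undo the
  -- contraction.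
  obtain ⟨ε₀, hε₀, hexp⟩ : ∃ ε₀ : ℝ, 0 < ε₀ ∧ Real.exp (ε₀ * L) * (1 - δ) < 1 := by
    have h1 : Tendsto (fun e : ℝ => Real.exp (e * L) * (1 - δ)) (𝓝[>] 0)
        (𝓝 (Real.exp (0 * L) * (1 - δ))) := by
      apply Tendsto.mono_left _ nhdsWithin_le_nhds
      exact Continuous.tendsto (by fun_prop) 0
    have h2 : Real.exp (0 * L) * (1 - δ) < 1 := by simp [hδ0]
    obtain ⟨e, he, he0⟩ := ((h1.eventually_lt_const h2).and self_mem_nhdsWithin).exists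
    exact ⟨e, he0, he⟩
  refine ⟨ε₀, hε₀, ?_⟩
  intro W c t₀ ht₀ hc0 hcont hW0 hd
  set E := Real.exp (ε₀ * L) with hE
  have hE1 : 1 ≤ E := Real.one_le_exp (by positivity)
  -- one block of `N` windows
  have block : ∀ k M, t₀ ≤ T k → 0 < M → (∀ i, W i (T k) ≤ M) →
      (∀ i, W i (T (k + N)) ≤ E * ((1 - δ) * M + c * L)) ∧
      ∀ i, ∀ t ∈ Icc (T k) (T (k + N)), W i t ≤ E * (M + c * L) := by
    intro k M hk hM hWM
    have hTk : 0 ≤ T k := ht₀.trans hk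
    -- The exponential factor removes the growth and the linear term absorbs the forcing; the latter
    -- is common to all nodes, so it cancels in differences.
    set U : Fin (N + 1) → ℝ → ℝ := fun i t =>
      Real.exp (-ε₀ * (t - T k)) * W i t + (-c * (t - T k)) with hU
    have hexpd : ∀ t, HasDerivAt (fun t => Real.exp (-ε₀ * (t - T k)))
        (-ε₀ * Real.exp (-ε₀ * (t - T k))) t := by
      intro t
      exact ((((hasDerivAt_id t).sub_const (T k)).const_mul (-ε₀)).exp).congr_deriv (by simp; ring)
    have hlind : ∀ t, HasDerivAt (fun t => -c * (t - T k)) (-c) t := by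
      intro t
      exact (((hasDerivAt_id t).sub_const (T k)).const_mul (-c)).congr_deriv (by ring)
    have hUc : ∀ i, ContinuousOn (U i) (Icc (T k) (T (k + N))) := by
      intro i
      have : ContinuousOn (W i) (Icc (T k) (T (k + N))) :=
        (hcont i).mono fun t ht => hTk.trans ht.1
      fun_prop
    have hUd : ∀ i, ∀ t ∈ Ico (T k) (T (k + N)),
        RightDiniLE (U i) t (∑ l, μ * adj net sig t i l * (U l t - U i t)) := by
      intro i t ht
      refine (((hd i t (hk.trans ht.1)).mul_left (hexpd t).hasDerivWithinAt
        (Real.exp_pos _)).add (rightDiniLE_of_hasDerivWithinAt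
          (hlind t).hasDerivWithinAt)).mono ?_
      have hle : Real.exp (-ε₀ * (t - T k)) ≤ 1 :=
        Real.exp_le_one_iff.2 (by nlinarith [ht.1])
      have e : ∑ l, μ * adj net sig t i l * (U l t - U i t)
          = Real.exp (-ε₀ * (t - T k)) * ∑ l, μ * adj net sig t i l * (W l t - W i t) := by
        rw [Finset.mul_sum]
        refine Finset.sum_congr rfl fun l _ => ?_
        simp only [hU]; ring
      rw [e]
      nlinarith
    have hU0 : U 0 (T k) ≤ 0 := by simp [hU, hW0 _ hTk]
    have hUM : ∀ i, U i (T k) ≤ M := by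
      intro i; simpa [hU] using hWM i
    have back : ∀ i, ∀ t ∈ Icc (T k) (T (k + N)), ∀ B, 0 ≤ B → U i t ≤ B →
        W i t ≤ E * (B + c * L) := by
      intro i t ht B hB0 hB
      have h1 : t - T k ≤ L := by linarith [hTlen k N, ht.2]
      have h0 : 0 ≤ t - T k := by linarith [ht.1]
      have h2 : Real.exp (-ε₀ * (t - T k)) * W i t ≤ B + c * L := by
        have : c * (t - T k) ≤ c * L := by gcongr
        simp only [hU] at hB
        linarith
      have h3 : W i t = Real.exp (ε₀ * (t - T k)) * (Real.exp (-ε₀ * (t - T k)) * W i t) := by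
        rw [← mul_assoc, ← Real.exp_add]; simp
      rw [h3]
      calc _ ≤ Real.exp (ε₀ * (t - T k)) * (B + c * L) := by gcongr
        _ ≤ E * (B + c * L) := by
          have : Real.exp (ε₀ * (t - T k)) ≤ E := by rw [hE]; gcongr
          gcongr
    refine ⟨fun i => ?_, fun i t ht => ?_⟩
    · refine back i _ ⟨hTm (by omega), le_rfl⟩ _ ?_ (hδ k U M hM hUc hUd hU0 hUM i)
      exact mul_nonneg (by linarith) hM.le
    · exact back i t ht M hM.le (le_of_consensus_inequality
        (w := fun t i l => μ * adj net sig t i l)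
        (fun t _ i l => mul_nonneg hμ.le (adj_nonneg net sig t i l)) hUc hUd hUM i t ht)
  obtain ⟨k₀, hk₀⟩ := (hTtop.eventually_ge_atTop t₀).exists
  set ρ := E * (1 - δ) with hρ
  have hρ1 : ρ < 1 := hexp
  -- M is large enough that the block map M ↦ ρ M + E c L does not increase it.
  obtain ⟨M, hM0, hMc, hMW⟩ : ∃ M, 0 < M ∧ E * c * L ≤ (1 - ρ) * M ∧ ∀ i, W i (T k₀) ≤ M := by
    refine ⟨1 + E * c * L / (1 - ρ) + ∑ i, |W i (T k₀)|, ?_, ?_, ?_⟩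
    · have : 0 ≤ E * c * L / (1 - ρ) := div_nonneg (by positivity) (by linarith)
      positivity
    · have h1 : 0 < 1 - ρ := by linarith
      have h2 : (1 - ρ) * (E * c * L / (1 - ρ)) = E * c * L := by field_simp
      have h3 : 0 ≤ ∑ i, |W i (T k₀)| := by positivity
      nlinarith
    · intro i
      have h1 : 0 ≤ E * c * L / (1 - ρ) := div_nonneg (by positivity) (by linarith)
      have h2 := Finset.single_le_sum (f := fun i => |W i (T k₀)|) (fun i _ => abs_nonneg _)
        (Finset.mem_univ i)
      have h3 := le_abs_self (W i (T k₀))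
      linarith
  have hblocks : ∀ m : ℕ, ∀ i, W i (T (k₀ + m * N)) ≤ M := by
    intro m
    induction m with
    | zero => simpa using hMW
    | succ m ih =>
      intro i
      have h1 := (block (k₀ + m * N) M (hk₀.trans (hTm (by omega))) hM0 ih).1 i
      have e : k₀ + (m + 1) * N = k₀ + m * N + N := by ring
      rw [e]
      refine h1.trans ?_
      have : E * ((1 - δ) * M + c * L) = ρ * M + E * c * L := by rw [hρ]; ring
      linarith
  have hinit : ∃ K₁, ∀ i, ∀ t ∈ Icc t₀ (T k₀), W i t ≤ K₁ := by
    have h1 : ∀ i, ∃ K, ∀ t ∈ Icc t₀ (T k₀), W i t ≤ K := by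
      intro i
      obtain ⟨K, hK⟩ := isCompact_Icc.bddAbove_image
        ((hcont i).mono fun t (ht : t ∈ Icc t₀ (T k₀)) => ht₀.trans ht.1)
      exact ⟨K, fun t ht => hK ⟨t, ht, rfl⟩⟩
    choose K hK using h1
    refine ⟨∑ i, |K i|, fun i t ht => ((hK i t ht).trans (le_abs_self _)).trans ?_⟩
    exact Finset.single_le_sum (f := fun i => |K i|) (fun i _ => abs_nonneg _) (Finset.mem_univ i)
  obtain ⟨K₁, hK₁⟩ := hinit
  refine ⟨max K₁ (E * (M + c * L)), fun i t ht => ?_⟩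
  rcases le_total t (T k₀) with h | h
  · exact (hK₁ i t ⟨ht, h⟩).trans (le_max_left _ _)
  · refine le_trans ?_ (le_max_right _ _)
    -- For N = 0 blocks have zero length and never reach t, but then the leader is the only node.
    rcases Nat.eq_zero_or_pos N with hN | hN
    · subst hN
      have hi : i = 0 := Fin.ext (by have := i.isLt; omega)
      rw [hi, hW0 t (ht₀.trans ht)]
      positivity
    · have hex : ∃ m : ℕ, t < T (k₀ + m * N) := by
        obtain ⟨m, hm⟩ := (hTtop.eventually_gt_atTop t).exists
        exact ⟨m, hm.trans_le (hTm (by nlinarith))⟩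
      classical
      -- The first block endpoint beyond t identifies the block containing t.
      have hspec := Nat.find_spec hex
      have hne : Nat.find hex ≠ 0 := by
        intro h0
        rw [h0] at hspec
        simp only [zero_mul, add_zero] at hspec
        linarith
      obtain ⟨m, hm⟩ := Nat.exists_eq_succ_of_ne_zero hne
      have hmin := Nat.find_min hex (m := m) (by omega)
      rw [hm] at hspec
      push Not at hmin
      have e : k₀ + m.succ * N = k₀ + m * N + N := by rw [Nat.succ_mul, add_assoc]
      rw [e] at hspec
      exact (block (k₀ + m * N) M (hk₀.trans (hTm (by omega))) hM0 (hblocks m)).2 i t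
        ⟨hmin, hspec.le⟩

end FESMS

/-! ### Adapted norms for a drift without unstable eigenvalues -/

namespace FESMS

open Set Filter Topology

variable {N q n : ℕ} {E : Type*} [NormedAddCommGroup E] [NormedSpace ℝ E]

/-- For every `ε > 0` there is an equivalent norm whose logarithmic norm of `A` is at most `ε`. -/
def QuasiDissipative (A : E →ₗ[ℝ] E) : Prop :=
  ∀ ε : ℝ, 0 < ε → ∃ p : Seminorm ℝ E, (∃ C : ℝ, ∀ v, p v ≤ C * ‖v‖) ∧ (∀ v, ‖v‖ ≤ p v) ∧
    ∀ᶠ h in 𝓝[>] (0 : ℝ), ∀ v, p (v + h • A v) ≤ (1 + ε * h) * p v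

theorem quasiDissipative_neg_smul_id {a : ℝ} (ha : 0 ≤ a) :
    QuasiDissipative (-(a • LinearMap.id) : E →ₗ[ℝ] E) := by
  intro ε hε
  refine ⟨normSeminorm ℝ E, ⟨1, fun v => by simp⟩, fun v => le_rfl, ?_⟩
  have h1 : (0 : ℝ) < 1 / (a + 1) := by positivity
  filter_upwards [Ioo_mem_nhdsGT h1] with h hh v
  have h2 : h * a ≤ 1 := by
    have := (lt_div_iff₀ (by positivity)).1 hh.2
    nlinarith [hh.1]
  have e : v + h • (-(a • LinearMap.id) : E →ₗ[ℝ] E) v = (1 - h * a) • v := by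
    simp only [LinearMap.neg_apply, LinearMap.smul_apply, LinearMap.id_coe, id_eq, smul_neg,
      sub_smul, one_smul, mul_smul]
    abel
  rw [e, coe_normSeminorm, norm_smul, Real.norm_eq_abs, abs_of_nonneg (by linarith)]
  have : 0 ≤ h * a := mul_nonneg hh.1.le ha
  have : 0 ≤ ε * h := mul_nonneg hε.le hh.1.le
  gcongr
  linarith

/-- Power bounds on an explicit Euler step give an adapted norm. -/
theorem exists_adapted_seminorm {A : E →ₗ[ℝ] E} {ε h C : ℝ} (hε : 0 < ε) (hh : 0 < h)
    (hC : ∀ (m : ℕ) v, ‖((1 + h • A : Module.End ℝ E) ^ m) v‖ ≤ C * (1 + ε * h) ^ m * ‖v‖) :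
    ∃ p : Seminorm ℝ E, (∃ C : ℝ, ∀ v, p v ≤ C * ‖v‖) ∧ (∀ v, ‖v‖ ≤ p v) ∧
      ∀ᶠ h in 𝓝[>] (0 : ℝ), ∀ v, p (v + h • A v) ≤ (1 + ε * h) * p v := by
  set B : Module.End ℝ E := 1 + h • A with hB
  set r : ℝ := 1 + ε * h with hr
  have hr0 : 0 < r := by positivity
  set a : E → ℕ → ℝ := fun v m => ‖(B ^ m) v‖ / r ^ m with ha
  have hle : ∀ v m, a v m ≤ C * ‖v‖ := by
    intro v m
    simp only [ha]
    rw [div_le_iff₀ (by positivity)]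
    linarith [hC m v]
  have hbdd : ∀ v, BddAbove (range (a v)) := by
    intro v
    refine ⟨C * ‖v‖, ?_⟩
    rintro _ ⟨m, rfl⟩
    exact hle v m
  -- p v is the supremum of ‖B^m v‖ / r^m; shifting the index gives p (B v) ≤ r p v.
  let p : Seminorm ℝ E := Seminorm.of (fun v => ⨆ m, a v m)
    (by
      intro v w
      refine ciSup_le fun m => ?_
      refine le_trans ?_ (add_le_add (le_ciSup (hbdd v) m) (le_ciSup (hbdd w) m))
      simp only [ha, map_add]
      rw [← add_div]
      gcongr
      exact norm_add_le _ _)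
    (by
      intro c v
      rw [Real.mul_iSup_of_nonneg (norm_nonneg c)]
      congr 1
      funext m
      simp only [ha, map_smul, norm_smul, mul_div_assoc])
  have hp : ∀ v, p v = ⨆ m, a v m := fun v => rfl
  have hstep : ∀ v, p (B v) ≤ r * p v := by
    intro v
    rw [hp, hp]
    refine ciSup_le fun m => ?_
    have h1 : a (B v) m = r * a v (m + 1) := by
      simp only [ha, pow_succ, Module.End.mul_apply]
      field_simp
    rw [h1]
    exact mul_le_mul_of_nonneg_left (le_ciSup (hbdd v) (m + 1)) hr0.le
  refine ⟨p, ⟨C, fun v => ?_⟩, fun v => ?_, ?_⟩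
  · rw [hp]; exact ciSup_le (hle v)
  · rw [hp]
    refine le_trans (le_of_eq ?_) (le_ciSup (hbdd v) 0)
    simp [ha]
  · filter_upwards [Ioo_mem_nhdsGT hh] with k hk v
    -- An Euler step shorter than h is a convex combination of the identity and B.
    set s := k / h with hs
    have hs0 : 0 < s := div_pos hk.1 hh
    have hs1 : s < 1 := (div_lt_one hh).2 hk.2
    have hsh : s * h = k := by rw [hs]; field_simp
    have e : v + k • A v = (1 - s) • v + s • B v := by
      simp only [hB, LinearMap.add_apply, Module.End.one_apply, LinearMap.smul_apply, smul_add,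
        sub_smul, one_smul, smul_smul, hsh]
      abel
    rw [e]
    have h1 := map_add_le_add p ((1 - s) • v) (s • B v)
    rw [map_smul_eq_mul, map_smul_eq_mul, Real.norm_eq_abs, Real.norm_eq_abs,
      abs_of_pos hs0, abs_of_pos (sub_pos.2 hs1)] at h1
    have h2 := mul_le_mul_of_nonneg_left (hstep v) hs0.le
    have h3 : (1 - s) * p v + s * (r * p v) = (1 + ε * (s * h)) * p v := by rw [hr]; ring
    rw [hsh] at h3
    linarith

/-- By Gelfand's formula, powers of an element grow at most like `r ^ m` for every `r` above
its spectral radius. -/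
theorem exists_norm_pow_le {𝔸 : Type*} [NormedRing 𝔸] [NormedAlgebra ℂ 𝔸] [CompleteSpace 𝔸]
    {b : 𝔸} {r : NNReal} (hr : spectralRadius ℂ b < r) :
    ∃ C : ℝ, ∀ m : ℕ, ‖b ^ m‖ ≤ C * (r : ℝ) ^ m := by
  have hr0 : 0 < r := by
    have := (zero_le).trans_lt hr
    exact_mod_cast this
  have h1 := spectrum.pow_nnnorm_pow_one_div_tendsto_nhds_spectralRadius b
  have h2 : ∀ᶠ m : ℕ in atTop, ‖b ^ m‖ ≤ (r : ℝ) ^ m := by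
    filter_upwards [h1.eventually_lt_const hr, eventually_gt_atTop 0] with m hm hm0
    have h3 : (((‖b ^ m‖₊ : ENNReal) ^ (1 / (m : ℝ))) ^ (m : ℝ)) ≤ (r : ENNReal) ^ (m : ℝ) :=
      ENNReal.rpow_le_rpow hm.le (by positivity)
    rw [← ENNReal.rpow_mul, one_div_mul_cancel (by positivity), ENNReal.rpow_one,
      ENNReal.rpow_natCast] at h3
    exact_mod_cast h3
  obtain ⟨m₀, hm₀⟩ := eventually_atTop.1 h2
  -- The sum absorbs the finitely many exponents before Gelfand's bound takes effect.
  refine ⟨1 + ∑ m ∈ Finset.range m₀, ‖b ^ m‖ / (r : ℝ) ^ m, fun m => ?_⟩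
  have hrm : (0 : ℝ) < (r : ℝ) ^ m := pow_pos (by exact_mod_cast hr0) m
  have hnn : ∀ m ∈ Finset.range m₀, 0 ≤ ‖b ^ m‖ / (r : ℝ) ^ m := fun m _ => by positivity
  rcases lt_or_ge m m₀ with h | h
  · have := Finset.single_le_sum hnn (Finset.mem_range.2 h)
    rw [div_le_iff₀ hrm] at this
    nlinarith
  · have h3 := hm₀ m h
    have := Finset.sum_nonneg hnn
    nlinarith

/-- If Re w ≤ 0 and |w| ≤ K, then |1 + hw|² ≤ 1 + h²K², which is below (1 + εh)² once hK² ≤ ε. So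
the complexified Euler step has spectral radius below 1 + εh, its powers obey the bound of
`exists_norm_pow_le`, and `exists_adapted_seminorm` applies. -/
theorem quasiDissipative_mulVecLin {S : Matrix (Fin q) (Fin q) ℝ}
    (hS : NoEigenvalueWithPosRe S) : QuasiDissipative (Matrix.mulVecLin S) := by
  intro ε hε
  set A : Module.End ℂ (Fin q → ℂ) := Matrix.toLin' (S.map Complex.ofReal) with hA
  set a : (Fin q → ℂ) →L[ℂ] (Fin q → ℂ) :=
    Module.End.toContinuousLinearMap (Fin q → ℂ) A with hadef
  -- The factor ‖1‖ matters only for q = 0, where it vanishes.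
  set K : ℝ := ‖a‖ * ‖(1 : (Fin q → ℂ) →L[ℂ] (Fin q → ℂ))‖ with hK
  have hK0 : 0 ≤ K := by positivity
  have hspec : ∀ w ∈ spectrum ℂ a, w.re ≤ 0 ∧ ‖w‖ ≤ K := by
    intro w hw
    refine ⟨hS w ?_, spectrum.norm_le_norm_mul_of_mem hw⟩
    rw [hadef, AlgEquiv.spectrum_eq] at hw
    exact Module.End.hasEigenvalue_iff_mem_spectrum.2 hw
  set h : ℝ := ε / (K ^ 2 + 1) with hh
  have hh0 : 0 < h := by positivity
  have hhK : h * K ^ 2 ≤ ε := by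
    have : h * (K ^ 2 + 1) = ε := by rw [hh]; field_simp
    nlinarith
  set b : (Fin q → ℂ) →L[ℂ] (Fin q → ℂ) :=
    1 + algebraMap ℂ ((Fin q → ℂ) →L[ℂ] (Fin q → ℂ)) h * a with hb
  have hbspec : ∀ z ∈ spectrum ℂ b, ‖z‖ ≤ Real.sqrt (1 + h ^ 2 * K ^ 2) := by
    intro z hz
    have hz1 : (z - 1) / h ∈ spectrum ℂ a := by
      have hne : (h : ℂ) ≠ 0 := by exact_mod_cast hh0.ne'
      intro hu
      apply hz
      have e : algebraMap ℂ ((Fin q → ℂ) →L[ℂ] (Fin q → ℂ)) z - b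
          = algebraMap ℂ ((Fin q → ℂ) →L[ℂ] (Fin q → ℂ)) h *
            (algebraMap ℂ ((Fin q → ℂ) →L[ℂ] (Fin q → ℂ)) ((z - 1) / h) - a) := by
        rw [mul_sub, ← map_mul, mul_div_cancel₀ _ hne, map_sub, map_one, hb]
        abel
      change IsUnit _
      rw [e]
      exact (hne.isUnit.map (algebraMap ℂ ((Fin q → ℂ) →L[ℂ] (Fin q → ℂ)))).mul hu
    obtain ⟨h1, h2⟩ := hspec _ hz1
    set w := (z - 1) / h with hw
    have hzw : z = 1 + h * w := by
      rw [hw, mul_div_cancel₀ _ (by exact_mod_cast hh0.ne')]; ring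
    apply Real.le_sqrt_of_sq_le
    have hn : ‖z‖ ^ 2 = 1 + 2 * h * w.re + h ^ 2 * ‖w‖ ^ 2 := by
      rw [← Complex.normSq_eq_norm_sq, ← Complex.normSq_eq_norm_sq, hzw, Complex.normSq_apply,
        Complex.normSq_apply]
      simp
      ring
    rw [hn]
    have h3 : ‖w‖ ^ 2 ≤ K ^ 2 := by gcongr
    have h4 : h ^ 2 * ‖w‖ ^ 2 ≤ h ^ 2 * K ^ 2 := by gcongr
    nlinarith [mul_nonneg hh0.le (neg_nonneg.2 h1)]
  have hr0 : 0 ≤ 1 + ε * h := by positivity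
  have hrad : spectralRadius ℂ b < (Real.toNNReal (1 + ε * h) : ENNReal) := by
    refine lt_of_le_of_lt (b := ((Real.toNNReal (Real.sqrt (1 + h ^ 2 * K ^ 2)) : NNReal) : ENNReal))
      (iSup₂_le fun z hz => ?_) ?_
    · have := hbspec z hz
      rw [ENNReal.coe_le_coe, ← NNReal.coe_le_coe, coe_nnnorm,
        Real.coe_toNNReal _ (Real.sqrt_nonneg _)]
      exact this
    · rw [ENNReal.coe_lt_coe, Real.toNNReal_lt_toNNReal_iff (by positivity)]
      rw [Real.sqrt_lt' (by positivity)]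
      have : h ^ 2 * K ^ 2 = h * (h * K ^ 2) := by ring
      have h5 : h * (h * K ^ 2) ≤ h * ε := by gcongr
      nlinarith [mul_pos hε hh0]
  obtain ⟨C, hC⟩ := exists_norm_pow_le hrad
  rw [Real.coe_toNNReal _ hr0] at hC
  refine exists_adapted_seminorm hε hh0 (C := C) fun m v => ?_
  -- The coordinatewise embedding of real into complex vectors preserves the sup norm and
  -- intertwines the two Euler steps, so the complex power bound descends.
  have hcpx : ∀ v : Fin q → ℝ, ‖(fun i => (v i : ℂ))‖ = ‖v‖ := by
    intro v
    simp [Pi.norm_def]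
  have hint : ∀ (m : ℕ) (v : Fin q → ℝ),
      (fun i => ((((1 + h • Matrix.mulVecLin S : Module.End ℝ (Fin q → ℝ)) ^ m) v i : ℝ) : ℂ))
        = (b ^ m) (fun i => (v i : ℂ)) := by
    intro m
    induction m with
    | zero => intro v; simp
    | succ m ih =>
      intro v
      rw [pow_succ, pow_succ, Module.End.mul_apply, ih, mul_apply_eq_comp]
      congr 1
      funext i
      simp [hb, hadef, hA, Matrix.mulVec, dotProduct, Module.End.toContinuousLinearMap]
  rw [← hcpx, hint, ← hcpx v]
  exact ((b ^ m).le_opNorm _).trans (mul_le_mul_of_nonneg_right (hC m) (norm_nonneg _))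

/-- Differential inequality for an adapted norm along a consensus dynamics. -/
theorem rightDiniLE_seminorm {ι : Type*} [Fintype ι] {p : Seminorm ℝ E} {C ε t : ℝ}
    {A : E →ₗ[ℝ] E} (hC : ∀ v, p v ≤ C * ‖v‖)
    (hA : ∀ᶠ h in 𝓝[>] (0 : ℝ), ∀ v, p (v + h • A v) ≤ (1 + ε * h) * p v)
    {z : ℝ → E} {y : ι → E} {b : ι → ℝ} {f : E} (hb : ∀ j, 0 ≤ b j)
    (hz : HasDerivWithinAt z (A (z t) + ∑ j, b j • (y j - z t) + f) (Ici t) t) :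
    RightDiniLE (fun s => p (z s)) t (ε * p (z t) + ∑ j, b j * (p (y j) - p (z t)) + p f) := by
  intro r hr
  set v := A (z t) + ∑ j, b j • (y j - z t) + f with hv
  have h1 := (hasDerivWithinAt_iff_tendsto_slope' (self_notMem_Ioi (a := t))).1
    (hz.mono Ioi_subset_Ici_self)
  have h2 : Tendsto (fun s => C * ‖slope z t s - v‖) (𝓝[>] t) (𝓝 0) := by
    have := ((tendsto_iff_norm_sub_tendsto_zero.1 h1).const_mul C)
    simpa using this
  have hshift : Tendsto (fun s : ℝ => 2 * (s - t)) (𝓝[>] t) (𝓝[>] 0) := by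
    apply tendsto_nhdsWithin_of_tendsto_nhds_of_eventually_within
    · apply Tendsto.mono_left _ nhdsWithin_le_nhds
      have : Continuous fun s : ℝ => 2 * (s - t) := by fun_prop
      simpa using this.tendsto t
    · filter_upwards [self_mem_nhdsWithin] with s hs
      have : 0 < s - t := sub_pos.2 hs
      simp only [mem_Ioi]; linarith
  have hB0 : 0 ≤ ∑ j, b j := Finset.sum_nonneg fun j _ => hb j
  have hBs : ∀ᶠ s in 𝓝[>] t, 2 * (s - t) * ∑ j, b j ≤ 1 := by
    have : (0 : ℝ) < 1 / (∑ j, b j + 1) := by positivity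
    filter_upwards [hshift.eventually (Ioo_mem_nhdsGT this)] with s hs
    have h3 := (lt_div_iff₀ (by positivity)).1 hs.2
    have := hs.1
    nlinarith
  filter_upwards [h2.eventually_lt_const (sub_pos.2 hr), hshift.eventually hA, hBs,
    self_mem_nhdsWithin] with s hs1 hs2 hs3 hs4
  set k := s - t with hk
  have hk0 : 0 < k := sub_pos.2 hs4
  have hzs : z s = z t + k • v + k • (slope z t s - v) := by
    have : k • slope z t s = z s - z t := by
      rw [slope_def_module, smul_smul, mul_inv_cancel₀ hk0.ne', one_smul]
    rw [smul_sub, this]; abel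
  -- Half of the step goes to the drift and half to coupling and forcing, each run with doubled
  -- length 2k. The first is bounded by `hA`, the second by subadditivity, with 1 - 2k ∑ b ≥ 0.
  have hsplit : z t + k • v = (1 / 2 : ℝ) • (z t + (2 * k) • A (z t)) +
      (1 / 2 : ℝ) • ((1 - 2 * k * ∑ j, b j) • z t + ∑ j, (2 * k * b j) • y j + (2 * k) • f) := by
    have e1 : ∑ j, b j • (y j - z t) = ∑ j, b j • y j - (∑ j, b j) • z t := by
      simp only [smul_sub, Finset.sum_sub_distrib, Finset.sum_smul]
    have e2 : ∑ j, (2 * k * b j) • y j = (2 * k) • ∑ j, b j • y j := by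
      simp only [Finset.smul_sum, smul_smul]
    rw [hv, e1, e2]
    module
  have hsum : p (∑ j, (2 * k * b j) • y j) ≤ ∑ j, 2 * k * b j * p (y j) := by
    refine (Finset.le_sum_of_subadditive p (by simp) (map_add_le_add p) _ _).trans (le_of_eq ?_)
    refine Finset.sum_congr rfl fun j _ => ?_
    rw [map_smul_eq_mul, Real.norm_eq_abs, abs_of_nonneg (by have := hb j; positivity)]
  have hq : p ((1 - 2 * k * ∑ j, b j) • z t + ∑ j, (2 * k * b j) • y j + (2 * k) • f)
      ≤ (1 - 2 * k * ∑ j, b j) * p (z t) + ∑ j, 2 * k * b j * p (y j) + 2 * k * p f := by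
    refine (map_add_le_add p _ _).trans (add_le_add ((map_add_le_add p _ _).trans
      (add_le_add ?_ hsum)) ?_)
    · rw [map_smul_eq_mul, Real.norm_eq_abs, abs_of_nonneg (by linarith)]
    · rw [map_smul_eq_mul, Real.norm_eq_abs, abs_of_nonneg (by linarith)]
  have hmain : p (z t + k • v) ≤
      p (z t) + k * (ε * p (z t) + ∑ j, b j * (p (y j) - p (z t)) + p f) := by
    rw [hsplit]
    refine (map_add_le_add p _ _).trans ?_
    rw [map_smul_eq_mul, map_smul_eq_mul, Real.norm_eq_abs, abs_of_pos (by norm_num)]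
    have e1 : ∑ j, b j * (p (y j) - p (z t)) = ∑ j, b j * p (y j) - (∑ j, b j) * p (z t) := by
      simp only [mul_sub, Finset.sum_sub_distrib, Finset.sum_mul]
    have e2 : ∑ j, 2 * k * b j * p (y j) = 2 * k * ∑ j, b j * p (y j) := by
      simp only [Finset.mul_sum, mul_assoc]
    rw [e2] at hq
    rw [e1]
    have := hs2 (z t)
    nlinarith
  have herr : p (k • (slope z t s - v)) ≤ k * (C * ‖slope z t s - v‖) := by
    rw [map_smul_eq_mul, Real.norm_eq_abs, abs_of_pos hk0]
    exact mul_le_mul_of_nonneg_left (hC _) hk0.le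
  have hfin : p (z s) ≤ p (z t + k • v) + p (k • (slope z t s - v)) := by
    conv_lhs => rw [hzs]
    exact map_add_le_add p _ _
  rw [slope_def_field, div_lt_iff₀ hk0]
  have := mul_lt_mul_of_pos_left hs1 hk0
  nlinarith

end FESMS

/-! ### Exponential decay, subexponential growth, and the consensus estimate -/

namespace FESMS

open Set Filter Topology Asymptotics

variable {N q n : ℕ} {E : Type*} [NormedAddCommGroup E]

/-- `f` decays exponentially. -/
def ExpDecay (f : ℝ → E) : Prop :=
  ∃ r : ℝ, 0 < r ∧ f =O[atTop] fun t => Real.exp (-r * t)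

/-- `f` grows slower than every exponential. -/
def SubExp (f : ℝ → E) : Prop :=
  ∀ r : ℝ, 0 < r → f =O[atTop] fun t => Real.exp (r * t)

theorem isBigO_exp_of_le {r s : ℝ} (h : r ≤ s) :
    (fun t => Real.exp (r * t)) =O[atTop] fun t => Real.exp (s * t) := by
  refine IsBigO.of_bound 1 ?_
  filter_upwards [eventually_ge_atTop 0] with t ht
  rw [Real.norm_eq_abs, Real.norm_eq_abs, Real.abs_exp, Real.abs_exp, one_mul]
  gcongr

theorem ExpDecay.tendsto {f : ℝ → E} (hf : ExpDecay f) : Tendsto f atTop (𝓝 0) := by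
  obtain ⟨r, hr, h⟩ := hf
  refine h.trans_tendsto ?_
  refine Real.tendsto_exp_atBot.comp ?_
  exact tendsto_id.const_mul_atTop_of_neg (by linarith)

theorem ExpDecay.add {f g : ℝ → E} (hf : ExpDecay f) (hg : ExpDecay g) :
    ExpDecay fun t => f t + g t := by
  obtain ⟨r, hr, h⟩ := hf
  obtain ⟨s, hs, k⟩ := hg
  refine ⟨min r s, lt_min hr hs, ?_⟩
  exact (h.trans (isBigO_exp_of_le (neg_le_neg (min_le_left _ _)))).add
    (k.trans (isBigO_exp_of_le (neg_le_neg (min_le_right _ _))))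

theorem ExpDecay.congr {f g : ℝ → E} (hf : ExpDecay f) (h : ∀ t, 0 ≤ t → f t = g t) :
    ExpDecay g := by
  obtain ⟨r, hr, k⟩ := hf
  exact ⟨r, hr, k.congr' ((eventually_ge_atTop 0).mono h) EventuallyEq.rfl⟩

theorem ExpDecay.neg {f : ℝ → E} (hf : ExpDecay f) : ExpDecay fun t => -f t := by
  obtain ⟨r, hr, h⟩ := hf
  exact ⟨r, hr, h.neg_left⟩

theorem ExpDecay.sub {f g : ℝ → E} (hf : ExpDecay f) (hg : ExpDecay g) :
    ExpDecay fun t => f t - g t := by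
  simpa only [sub_eq_add_neg] using hf.add hg.neg

theorem expDecay_zero : ExpDecay fun _ : ℝ => (0 : E) := ⟨1, one_pos, isBigO_zero _ _⟩

theorem ExpDecay.sum {ι : Type*} {s : Finset ι} {f : ι → ℝ → E} (hf : ∀ i ∈ s, ExpDecay (f i)) :
    ExpDecay fun t => ∑ i ∈ s, f i t := by
  classical
  induction s using Finset.induction_on with
  | empty => simpa using expDecay_zero
  | insert a s ha ih =>
    simp only [Finset.sum_insert ha]
    exact (hf a (by simp)).add (ih fun i hi => hf i (by simp [hi]))

theorem ExpDecay.norm {f : ℝ → E} (hf : ExpDecay f) : ExpDecay fun t => ‖f t‖ := by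
  obtain ⟨r, hr, h⟩ := hf
  exact ⟨r, hr, h.norm_left⟩

theorem ExpDecay.const_mul {f : ℝ → ℝ} (hf : ExpDecay f) (c : ℝ) : ExpDecay fun t => c * f t := by
  obtain ⟨r, hr, h⟩ := hf
  exact ⟨r, hr, h.const_mul_left c⟩

theorem ExpDecay.apply {ι : Type*} [Fintype ι] {f : ℝ → ι → ℝ} (hf : ExpDecay f) (i : ι) :
    ExpDecay fun t => f t i := by
  obtain ⟨r, hr, h⟩ := hf
  exact ⟨r, hr, isBigO_pi.1 h i⟩

theorem ExpDecay.subExp {f : ℝ → E} (hf : ExpDecay f) : SubExp f := by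
  obtain ⟨r, hr, h⟩ := hf
  exact fun s hs => h.trans (isBigO_exp_of_le (by linarith))

/-- Half of the decay rate pays for the growth of the other factor; this is what admits unbounded
references. -/
theorem ExpDecay.mul_subExp {f g : ℝ → ℝ} (hf : ExpDecay f) (hg : SubExp g) :
    ExpDecay fun t => f t * g t := by
  obtain ⟨r, hr, h⟩ := hf
  refine ⟨r / 2, half_pos hr, (h.mul (hg (r / 2) (half_pos hr))).congr_right fun t => ?_⟩
  rw [← Real.exp_add]
  congr 1
  ring

theorem SubExp.congr {f g : ℝ → E} (hf : SubExp f) (h : ∀ t, 0 ≤ t → f t = g t) : SubExp g :=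
  fun r hr => (hf r hr).congr' ((eventually_ge_atTop 0).mono h) EventuallyEq.rfl

theorem SubExp.norm {f : ℝ → E} (hf : SubExp f) : SubExp fun t => ‖f t‖ :=
  fun r hr => (hf r hr).norm_left

theorem SubExp.const_mul {f : ℝ → ℝ} (hf : SubExp f) (c : ℝ) : SubExp fun t => c * f t :=
  fun r hr => (hf r hr).const_mul_left c

theorem SubExp.apply {ι : Type*} [Fintype ι] {f : ℝ → ι → ℝ} (hf : SubExp f) (i : ι) :
    SubExp fun t => f t i := fun r hr => isBigO_pi.1 (hf r hr) i

theorem SubExp.sum {ι : Type*} {s : Finset ι} {f : ι → ℝ → E} (hf : ∀ i ∈ s, SubExp (f i)) :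
    SubExp fun t => ∑ i ∈ s, f i t := fun r hr => IsBigO.fun_sum fun i hi => hf i hi r hr

variable [NormedSpace ℝ E]

theorem continuous_of_le_norm {p : Seminorm ℝ E} {C : ℝ} (hC : ∀ v, p v ≤ C * ‖v‖) :
    Continuous p := by
  have : LipschitzWith (Real.toNNReal C) p := by
    refine LipschitzWith.of_dist_le_mul fun x y => ?_
    rw [Real.dist_eq, dist_eq_norm]
    refine (abs_sub_map_le_sub p x y).trans ((hC _).trans ?_)
    gcongr
    exact Real.le_coe_toNNReal C
  exact this.continuous

/-- Leader-following consensus with a quasi-dissipative drift, a vanishing multiplicative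
perturbation and an exponentially decaying forcing term. -/
theorem expDecay_of_consensus {net : Network N n} {sig : SwitchingSignal n}
    (hconn : JointlyConnected net sig) {μ : ℝ} (hμ : 0 < μ) {A : E →ₗ[ℝ] E}
    (hA : QuasiDissipative A) {e : Fin (N + 1) → ℝ → E} {f : Fin N → ℝ → E} {θ g : ℝ → ℝ}
    (he0 : ∀ t, 0 ≤ t → e 0 t = 0)
    (he : ∀ i : Fin N, SolvesSwitched (e i.succ) fun t => A (e i.succ t) +
      μ • ∑ j, adj net sig t i.succ j • (e j t - e i.succ t) + f i t)
    (hf : ∀ i t, 0 ≤ t → ‖f i t‖ ≤ θ t * ‖e i.succ t‖ + g t)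
    (hθ : Tendsto θ atTop (𝓝 0)) (hg : ExpDecay g) (i : Fin (N + 1)) : ExpDecay (e i) := by
  obtain ⟨ε, hε, hbound⟩ := exists_growth_bounded net sig hconn hμ
  -- Budget for the admissible growth rate ε: ε/4 for the drift, ε/4 for the weight exp (l t), ε/2
  -- for the vanishing perturbation. Also l ≤ r, so the weighted forcing stays bounded.
  obtain ⟨p, ⟨C, hC⟩, hnorm, hAp⟩ := hA (ε / 4) (by positivity)
  obtain ⟨r, hr, hgr⟩ := hg
  obtain ⟨c, hc0, hc⟩ := hgr.exists_pos
  replace hc := hc.bound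
  have hC' : ∀ v, p v ≤ |C| * ‖v‖ := fun v =>
    (hC v).trans (mul_le_mul_of_nonneg_right (le_abs_self C) (norm_nonneg v))
  have hpc : Continuous p := continuous_of_le_norm hC
  set l := min r (ε / 4) with hl
  have hl0 : 0 < l := lt_min hr (by positivity)
  have hlr : l ≤ r := min_le_left _ _
  have hle : l ≤ ε / 4 := min_le_right _ _
  have hθ' : Tendsto (fun t => |C| * θ t) atTop (𝓝 0) := by simpa using hθ.const_mul |C|
  obtain ⟨t₀, ht₀⟩ := eventually_atTop.1
    ((hc.and (hθ'.eventually_lt_const (half_pos hε))).and (eventually_ge_atTop 0))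
  have ht₀0 : 0 ≤ t₀ := (ht₀ t₀ le_rfl).2
  set W : Fin (N + 1) → ℝ → ℝ := fun i t => Real.exp (l * t) * p (e i t) with hW
  have hWc : ∀ i, ContinuousOn (W i) (Ici 0) := by
    intro i
    have hexp : ContinuousOn (fun t : ℝ => Real.exp (l * t)) (Ici 0) := by fun_prop
    refine hexp.mul (hpc.comp_continuousOn ?_)
    refine Fin.cases ?_ (fun i => (he i).1) i
    exact continuousOn_const.congr he0
  have hW0 : ∀ t, 0 ≤ t → W 0 t = 0 := fun t ht => by simp [hW, he0 t ht]
  have hWd : ∀ i, ∀ t, t₀ ≤ t → RightDiniLE (W i) t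
      (ε * W i t + ∑ k, μ * adj net sig t i k * (W k t - W i t) + |C| * c) := by
    intro i t ht
    have ht0 : 0 ≤ t := ht₀0.trans ht
    refine Fin.cases ?_ (fun i => ?_) i
    · have h1 : RightDiniLE (W 0) t 0 := by
        apply rightDiniLE_of_hasDerivWithinAt
        exact (hasDerivWithinAt_const t (Ici t) (0 : ℝ)).congr
          (fun s hs => hW0 s (ht0.trans hs)) (hW0 t ht0)
      refine h1.mono ?_
      rw [hW0 t ht0]
      simp only [adj_zero, mul_zero, zero_mul, Finset.sum_const_zero, zero_add]
      positivity
    · have h1 := (he i).2 t ht0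
      simp only [Finset.smul_sum, smul_smul] at h1
      have h2 := rightDiniLE_seminorm (p := p) hC hAp
        (b := fun k => μ * adj net sig t i.succ k)
        (fun k => mul_nonneg hμ.le (adj_nonneg net sig t i.succ k)) h1
      have hexp : HasDerivAt (fun t => Real.exp (l * t)) (l * Real.exp (l * t)) t :=
        (((hasDerivAt_id t).const_mul l).exp).congr_deriv (by simp; ring)
      refine (h2.mul_left hexp.hasDerivWithinAt (Real.exp_pos _)).mono ?_
      have h3 : ∑ k, μ * adj net sig t i.succ k * (W k t - W i.succ t) = Real.exp (l * t) *
          ∑ k, μ * adj net sig t i.succ k * (p (e k t) - p (e i.succ t)) := by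
        rw [Finset.mul_sum]
        refine Finset.sum_congr rfl fun k _ => ?_
        simp only [hW]; ring
      rw [h3]
      set X := Real.exp (l * t) with hX
      have hX0 : 0 < X := Real.exp_pos _
      obtain ⟨⟨hb1, hb2⟩, -⟩ := ht₀ t ht
      have hp0 := apply_nonneg p (e i.succ t)
      have h4 : p (f i t) ≤ ε / 2 * p (e i.succ t) + |C| * (c * Real.exp (-r * t)) := by
        calc p (f i t) ≤ |C| * ‖f i t‖ := hC' _
          _ ≤ |C| * (θ t * ‖e i.succ t‖ + g t) := by gcongr; exact hf i t ht0
          _ = |C| * θ t * ‖e i.succ t‖ + |C| * g t := by ring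
          _ ≤ ε / 2 * ‖e i.succ t‖ + |C| * (c * Real.exp (-r * t)) := by
              gcongr
              rw [Real.norm_eq_abs, Real.norm_eq_abs, Real.abs_exp] at hb1
              exact (le_abs_self _).trans hb1
          _ ≤ _ := by gcongr; exact hnorm _
      have h5 : X * Real.exp (-r * t) ≤ 1 := by
        rw [hX, ← Real.exp_add]
        exact Real.exp_le_one_iff.2 (by nlinarith)
      have h6 : X * p (f i t) ≤ ε / 2 * (X * p (e i.succ t)) + |C| * c := by
        have h7 := mul_le_mul_of_nonneg_left h4 hX0.le
        have h8 : |C| * c * (X * Real.exp (-r * t)) ≤ |C| * c :=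
          mul_le_of_le_one_right (by positivity) h5
        nlinarith
      have h9 : l * (X * p (e i.succ t)) ≤ ε / 4 * (X * p (e i.succ t)) := by
        gcongr
      simp only [hW, ← hX]
      nlinarith
  obtain ⟨K, hK⟩ := hbound W (|C| * c) t₀ ht₀0 (by positivity) hWc hW0 hWd
  refine ⟨l, hl0, IsBigO.of_bound K ?_⟩
  filter_upwards [eventually_ge_atTop t₀] with t ht
  have h1 := hK i t ht
  simp only [hW] at h1
  rw [Real.norm_eq_abs, Real.abs_exp, neg_mul, Real.exp_neg, ← div_eq_mul_inv,
    le_div_iff₀ (Real.exp_pos _)]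
  have := mul_le_mul_of_nonneg_right (hnorm (e i t)) (Real.exp_pos (l * t)).le
  linarith

/-- Trajectories of an autonomous quasi-dissipative system grow subexponentially. -/
theorem subExp_of_quasiDissipative {A : E →ₗ[ℝ] E} (hA : QuasiDissipative A) {z : ℝ → E}
    (hz : Solves z fun t => A (z t)) : SubExp z := by
  intro r hr
  -- Rate r/2 makes the comparison with exp (r t) strict.
  obtain ⟨p, ⟨C, hC⟩, hnorm, hAp⟩ := hA (r / 2) (by positivity)
  have hpc : Continuous p := continuous_of_le_norm hC
  have hzc : ContinuousOn z (Ici 0) := fun t ht => (hz t ht).continuousWithinAt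
  have hd : ∀ t, 0 ≤ t → RightDiniLE (fun s => p (z s)) t (r / 2 * p (z t)) := by
    intro t ht
    -- An autonomous system is a consensus dynamics with an empty set of neighbours.
    have h1 : HasDerivWithinAt z (A (z t) + ∑ j : Fin 0, (0 : ℝ) • ((0 : E) - z t) + 0) (Ici t) t :=
      by simpa using (hz t ht).mono (Ici_subset_Ici.2 ht)
    simpa using rightDiniLE_seminorm (p := p) hC hAp (b := fun _ : Fin 0 => (0 : ℝ))
      (y := fun _ => (0 : E)) (fun j => le_rfl) h1
  set K := p (z 0) + 1 with hK
  have hK0 : 0 < K := by have := apply_nonneg p (z 0); positivity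
  refine IsBigO.of_bound K ?_
  filter_upwards [eventually_ge_atTop 0] with t ht
  rw [Real.norm_eq_abs, Real.abs_exp]
  refine (hnorm _).trans ?_
  refine le_of_rightDiniLE (f := fun s => p (z s)) (B := fun t => K * Real.exp (r * t))
    (B' := fun t => K * (r * Real.exp (r * t))) (b := t)
    (hpc.comp_continuousOn (hzc.mono fun s hs => hs.1)) (fun s hs => hd s hs.1) (by simp [hK])
    (fun s => ?_) (fun s hs h => ?_) t ⟨ht, le_rfl⟩
  · exact ((((hasDerivAt_id s).const_mul r).exp).const_mul K).congr_deriv (by simp only [id_eq, mul_one]; ring)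
  · rw [h]
    have : 0 < K * Real.exp (r * s) := by positivity
    nlinarith

/-- A stable scalar linear equation inherits the exponential order of its input. -/
theorem isBigO_exp_of_solves {k r : ℝ} (hkr : 0 < k + r) {z h : ℝ → ℝ}
    (hz : SolvesSwitched z fun t => -k * z t + h t)
    (hh : h =O[atTop] fun t => Real.exp (r * t)) : z =O[atTop] fun t => Real.exp (r * t) := by
  obtain ⟨c, hc0, hc⟩ := hh.exists_pos
  obtain ⟨t₀, ht₀⟩ := eventually_atTop.1 (hc.bound.and (eventually_ge_atTop 0))
  have ht₀0 : 0 ≤ t₀ := (ht₀ t₀ le_rfl).2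
  -- The first term makes K exp (r t) a strict supersolution, K (k + r) > c; the second dominates
  -- the value at t₀.
  set K := (c + 1) / (k + r) + |z t₀| / Real.exp (r * t₀) with hK
  have hKc : c < K * (k + r) := by
    have h1 : (c + 1) / (k + r) * (k + r) = c + 1 := by field_simp
    have h2 : 0 ≤ |z t₀| / Real.exp (r * t₀) * (k + r) := by positivity
    rw [hK, add_mul, h1]; linarith
  have hKz : |z t₀| ≤ K * Real.exp (r * t₀) := by
    rw [hK, add_mul, div_mul_cancel₀ _ (Real.exp_pos _).ne']
    have : 0 ≤ (c + 1) / (k + r) * Real.exp (r * t₀) := by positivity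
    linarith
  have hB : ∀ s, HasDerivAt (fun t => K * Real.exp (r * t)) (K * (r * Real.exp (r * s))) s :=
    fun s => ((((hasDerivAt_id s).const_mul r).exp).const_mul K).congr_deriv (by simp only [id_eq, mul_one]; ring)
  -- Stated for arbitrary z and h so as to apply to -z as well.
  have upper : ∀ (z h : ℝ → ℝ), SolvesSwitched z (fun t => -k * z t + h t) →
      (∀ t, t₀ ≤ t → |h t| ≤ c * Real.exp (r * t)) → z t₀ ≤ K * Real.exp (r * t₀) →
      ∀ t, t₀ ≤ t → z t ≤ K * Real.exp (r * t) := by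
    intro z h hz hh h0 t ht
    refine le_of_rightDiniLE (B := fun t => K * Real.exp (r * t)) (b := t)
      (hz.1.mono fun s hs => ht₀0.trans hs.1)
      (fun s hs => rightDiniLE_of_hasDerivWithinAt (hz.2 s (ht₀0.trans hs.1))) h0
      hB (fun s hs h => ?_) t ⟨ht, le_rfl⟩
    rw [h]
    have h1 := (le_abs_self _).trans (hh s hs.1)
    have := mul_lt_mul_of_pos_right hKc (Real.exp_pos (r * s))
    nlinarith
  have hhb : ∀ t, t₀ ≤ t → |h t| ≤ c * Real.exp (r * t) := fun t ht => by
    have := (ht₀ t ht).1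
    rwa [Real.norm_eq_abs, Real.norm_eq_abs, Real.abs_exp] at this
  refine IsBigO.of_bound K ?_
  filter_upwards [eventually_ge_atTop t₀] with t ht
  rw [Real.norm_eq_abs, Real.norm_eq_abs, Real.abs_exp, abs_le]
  constructor
  · have := upper (fun t => -z t) (fun t => -h t) ⟨hz.1.neg, fun s hs =>
      (hz.2 s hs).neg.congr_deriv (by ring)⟩ (fun s hs => by rw [abs_neg]; exact hhb s hs)
      ((neg_le_abs _).trans hKz) t ht
    linarith
  · exact upper z h hz hhb ((le_abs_self _).trans hKz) t ht

theorem SubExp.of_solves {k : ℝ} (hk : 0 ≤ k) {z h : ℝ → ℝ}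
    (hz : SolvesSwitched z fun t => -k * z t + h t) (hh : SubExp h) : SubExp z :=
  fun r hr => isBigO_exp_of_solves (by linarith) hz (hh r hr)

/-- The output decays no faster than both the input and the homogeneous solution; capping the rate
at k/2 keeps it strictly below k. -/
theorem ExpDecay.of_solves {k : ℝ} (hk : 0 < k) {z h : ℝ → ℝ}
    (hz : SolvesSwitched z fun t => -k * z t + h t) (hh : ExpDecay h) : ExpDecay z := by
  obtain ⟨r, hr, h1⟩ := hh
  refine ⟨min r (k / 2), lt_min hr (half_pos hk), isBigO_exp_of_solves ?_ hz
    (h1.trans (isBigO_exp_of_le (neg_le_neg (min_le_left _ _))))⟩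
  linarith [min_le_right r (k / 2)]

end FESMS

/-! ### Convergence of the closed-loop signals -/

namespace FESMS

open Set Filter Topology Asymptotics

variable {N q n : ℕ}

theorem Flywheels.gamma_pos (F : Flywheels N) (i : Fin N) : 0 < F.gamma i := by
  have := F.omegaMax_pos i
  unfold Flywheels.gamma
  positivity

theorem Flywheels.alpha0_nonneg (F : Flywheels N) : 0 ≤ F.alpha0 := by
  unfold Flywheels.alpha0
  have h1 : 0 ≤ ∑ i, F.friction i / F.gamma i :=
    Finset.sum_nonneg fun i _ => (div_pos (F.friction_pos i) (F.gamma_pos i)).le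
  have h2 : 0 ≤ ∑ i, F.inertia i / F.gamma i :=
    Finset.sum_nonneg fun i _ => (div_pos (F.inertia_pos i) (F.gamma_pos i)).le
  positivity

/-- Estimates of a constant leader signal converge exponentially. -/
theorem expDecay_of_static_consensus {E : Type*} [NormedAddCommGroup E] [NormedSpace ℝ E]
    {net : Network N n} {sig : SwitchingSignal n} (hconn : JointlyConnected net sig)
    {μ : ℝ} (hμ : 0 < μ) {y : Fin (N + 1) → ℝ → E} {y₀ : E} (h0 : ∀ t, 0 ≤ t → y 0 t = y₀)
    (hy : ∀ i : Fin N, SolvesSwitched (y i.succ) fun t =>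
      μ • ∑ j, adj net sig t i.succ j • (y j t - y i.succ t)) (i : Fin (N + 1)) :
    ExpDecay fun t => y i t - y₀ := by
  -- Zero drift: `le_rfl` selects a = 0 in -(a • id).
  refine expDecay_of_consensus hconn hμ (quasiDissipative_neg_smul_id le_rfl)
    (e := fun i t => y i t - y₀) (f := fun _ _ => 0) (θ := fun _ => 0) (g := fun _ => 0)
    (fun t ht => by simp [h0 t ht]) (fun i => ?_) (by simp) tendsto_const_nhds expDecay_zero i
  refine ⟨(hy i).1.sub continuousOn_const, fun t ht => ?_⟩
  refine (((hy i).2 t ht).sub_const y₀).congr_deriv ?_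
  simp

namespace IsClosedLoop

variable {F : Flywheels N} {S₀ : Matrix (Fin q) (Fin q) ℝ} {C₀ : Fin q → ℝ} {net : Network N n}
  {sig : SwitchingSignal n} {g : Gains} {x : Signals N q}

theorem expDecay_S (hx : IsClosedLoop F S₀ C₀ net sig g x) (hconn : JointlyConnected net sig)
    (i : Fin (N + 1)) (a b : Fin q) : ExpDecay fun t => x.S i t a b - S₀ a b :=
  expDecay_of_static_consensus hconn g.muS_pos (y := fun i t => x.S i t a b)
    (fun t ht => by simp only [hx.S_zero t ht]) (fun i => by simpa using hx.S i a b) i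

theorem expDecay_C (hx : IsClosedLoop F S₀ C₀ net sig g x) (hconn : JointlyConnected net sig)
    (i : Fin (N + 1)) : ExpDecay fun t => x.C i t - C₀ :=
  expDecay_of_static_consensus hconn g.muC_pos hx.C_zero hx.C i

theorem expDecay_alpha (hx : IsClosedLoop F S₀ C₀ net sig g x)
    (hconn : JointlyConnected net sig) (i : Fin (N + 1)) :
    ExpDecay fun t => x.alpha i t - F.alpha0 :=
  expDecay_of_static_consensus hconn g.muAlpha_pos hx.alpha_zero
    (fun i => by simpa using hx.alpha i) i

theorem expDecay_beta (hx : IsClosedLoop F S₀ C₀ net sig g x)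
    (hconn : JointlyConnected net sig) (i : Fin (N + 1)) :
    ExpDecay fun t => x.beta i t - F.beta0 :=
  expDecay_of_static_consensus hconn g.muBeta_pos hx.beta_zero
    (fun i => by simpa using hx.beta i) i

theorem subExp_eta_zero (hx : IsClosedLoop F S₀ C₀ net sig g x)
    (hS₀ : NoEigenvalueWithPosRe S₀) : SubExp (x.eta 0) :=
  subExp_of_quasiDissipative (quasiDissipative_mulVecLin hS₀) hx.eta_zero

theorem norm_mulVec_le_sum (M : Matrix (Fin q) (Fin q) ℝ) (v : Fin q → ℝ) :
    ‖M.mulVec v‖ ≤ (∑ a, ∑ b, |M a b|) * ‖v‖ := by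
  rw [pi_norm_le_iff_of_nonneg (by positivity)]
  intro a
  have h1 : ‖M.mulVec v a‖ ≤ ∑ b, |M a b| * ‖v‖ := by
    refine (norm_sum_le Finset.univ fun b => M a b * v b).trans (Finset.sum_le_sum fun b _ => ?_)
    rw [norm_mul, Real.norm_eq_abs]
    exact mul_le_mul_of_nonneg_left (norm_le_pi_norm v b) (abs_nonneg _)
  rw [← Finset.sum_mul] at h1
  refine h1.trans (mul_le_mul_of_nonneg_right ?_ (norm_nonneg v))
  exact Finset.single_le_sum (f := fun a => ∑ b, |M a b|)
    (fun a _ => Finset.sum_nonneg fun b _ => abs_nonneg _) (Finset.mem_univ a)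

/-- The error has drift `S₀` and extra term (S_i - S₀) η_i. Writing η_i as error plus η_0 splits
this into a vanishing multiple of the error and a decaying factor times a subexponential one. -/
theorem expDecay_eta (hx : IsClosedLoop F S₀ C₀ net sig g x) (hconn : JointlyConnected net sig)
    (hS₀ : NoEigenvalueWithPosRe S₀) (i : Fin (N + 1)) :
    ExpDecay fun t => x.eta i t - x.eta 0 t := by
  set θ : ℝ → ℝ := fun t => ∑ i : Fin N, ∑ a, ∑ b, |x.S i.succ t a b - S₀ a b| with hθ
  have hθe : ExpDecay θ := ExpDecay.sum fun i _ => ExpDecay.sum fun a _ => ExpDecay.sum fun b _ =>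
    (hx.expDecay_S hconn i.succ a b).norm
  refine expDecay_of_consensus hconn g.muEta_pos (quasiDissipative_mulVecLin hS₀)
    (e := fun i t => x.eta i t - x.eta 0 t)
    (f := fun i t => (x.S i.succ t - S₀).mulVec (x.eta i.succ t))
    (θ := θ) (g := fun t => θ t * ‖x.eta 0 t‖) (fun t _ => sub_self _) (fun i => ?_)
    (fun i t _ => ?_) hθe.tendsto (hθe.mul_subExp (hx.subExp_eta_zero hS₀).norm) i
  · refine ⟨(hx.eta i).1.sub fun t ht => (hx.eta_zero t ht).continuousWithinAt, fun t ht => ?_⟩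
    refine (((hx.eta i).2 t ht).sub
      ((hx.eta_zero t ht).mono (Ici_subset_Ici.2 ht))).congr_deriv ?_
    simp only [sub_sub_sub_cancel_right, Matrix.mulVecLin_apply, Matrix.mulVec_sub,
      Matrix.sub_mulVec]
    abel
  · refine (norm_mulVec_le_sum _ _).trans ?_
    have h1 : ∑ a, ∑ b, |(x.S i.succ t - S₀) a b| ≤ θ t :=
      Finset.single_le_sum (f := fun i : Fin N => ∑ a, ∑ b, |x.S i.succ t a b - S₀ a b|)
        (fun i _ => by positivity) (Finset.mem_univ i)
    have h0 : 0 ≤ θ t := by simp only [hθ]; positivity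
    have h2 : ‖x.eta i.succ t‖ ≤ ‖x.eta i.succ t - x.eta 0 t‖ + ‖x.eta 0 t‖ := by
      simpa using norm_add_le (x.eta i.succ t - x.eta 0 t) (x.eta 0 t)
    calc _ ≤ θ t * (‖x.eta i.succ t - x.eta 0 t‖ + ‖x.eta 0 t‖) := by gcongr
      _ = _ := by ring

theorem subExp_pRef_zero (hx : IsClosedLoop F S₀ C₀ net sig g x)
    (hS₀ : NoEigenvalueWithPosRe S₀) : SubExp (x.pRef 0) := by
  have h : SubExp fun t => ∑ k, C₀ k * x.eta 0 t k :=
    SubExp.sum fun k _ => ((hx.subExp_eta_zero hS₀).apply k).const_mul _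
  exact h.congr fun t ht => by simp [Signals.pRef, hx.C_zero t ht, dotProduct]

/-- Bilinear expansion ΔC Δη + ΔC η_0 + C₀ Δη. -/
theorem expDecay_pRef (hx : IsClosedLoop F S₀ C₀ net sig g x) (hconn : JointlyConnected net sig)
    (hS₀ : NoEigenvalueWithPosRe S₀) (i : Fin (N + 1)) :
    ExpDecay fun t => x.pRef i t - x.pRef 0 t := by
  have h : ExpDecay fun t => ∑ k, ((x.C i t - C₀) k * (x.eta i t - x.eta 0 t) k
      + (x.C i t - C₀) k * x.eta 0 t k + C₀ k * (x.eta i t - x.eta 0 t) k) :=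
    ExpDecay.sum fun k _ =>
      ((((hx.expDecay_C hconn i).apply k).mul_subExp
        ((hx.expDecay_eta hconn hS₀ i).apply k).subExp).add
      (((hx.expDecay_C hconn i).apply k).mul_subExp ((hx.subExp_eta_zero hS₀).apply k))).add
      (((hx.expDecay_eta hconn hS₀ i).apply k).const_mul _)
  refine h.congr fun t ht => ?_
  simp only [Signals.pRef, hx.C_zero t ht, dotProduct]
  rw [← Finset.sum_sub_distrib]
  refine Finset.sum_congr rfl fun k _ => ?_
  simp only [Pi.sub_apply]
  ring

theorem subExp_psi_zero (hx : IsClosedLoop F S₀ C₀ net sig g x)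
    (hS₀ : NoEigenvalueWithPosRe S₀) : SubExp (x.psi 0) := by
  refine SubExp.of_solves F.alpha0_nonneg (h := fun t => -F.beta0 * x.pRef 0 t)
    ⟨fun t ht => (hx.psi_zero t ht).continuousWithinAt, fun t ht => ?_⟩
    ((hx.subExp_pRef_zero hS₀).const_mul _)
  exact ((hx.psi_zero t ht).mono (Ici_subset_Ici.2 ht)).congr_deriv (by ring)

theorem expDecay_beta_mul_pRef (hx : IsClosedLoop F S₀ C₀ net sig g x)
    (hconn : JointlyConnected net sig) (hS₀ : NoEigenvalueWithPosRe S₀) (i : Fin (N + 1)) :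
    ExpDecay fun t => x.beta i t * x.pRef i t - F.beta0 * x.pRef 0 t := by
  have hβ := hx.expDecay_beta hconn i
  have hP := hx.expDecay_pRef hconn hS₀ i
  refine (((hβ.mul_subExp hP.subExp).add (hβ.mul_subExp (hx.subExp_pRef_zero hS₀))).add
    (hP.const_mul F.beta0)).congr fun t _ => ?_
  ring

/-- Same scheme as for η, with scalar drift -α₀; the error of β P is an additional decaying forcing.
-/
theorem expDecay_psi (hx : IsClosedLoop F S₀ C₀ net sig g x) (hconn : JointlyConnected net sig)
    (hS₀ : NoEigenvalueWithPosRe S₀) (i : Fin (N + 1)) :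
    ExpDecay fun t => x.psi i t - x.psi 0 t := by
  set θ : ℝ → ℝ := fun t => ∑ i : Fin N, |x.alpha i.succ t - F.alpha0| with hθ
  set Q : Fin N → ℝ → ℝ := fun i t => x.beta i.succ t * x.pRef i.succ t - F.beta0 * x.pRef 0 t
    with hQ
  have hθe : ExpDecay θ := ExpDecay.sum fun i _ => (hx.expDecay_alpha hconn i.succ).norm
  have hQe : ExpDecay fun t => ∑ i, |Q i t| :=
    ExpDecay.sum fun i _ => (hx.expDecay_beta_mul_pRef hconn hS₀ i.succ).norm
  refine expDecay_of_consensus hconn g.muPsi_pos (quasiDissipative_neg_smul_id F.alpha0_nonneg)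
    (e := fun i t => x.psi i t - x.psi 0 t)
    (f := fun i t => -(x.alpha i.succ t - F.alpha0) * x.psi i.succ t - Q i t)
    (θ := θ) (g := fun t => θ t * ‖x.psi 0 t‖ + ∑ i, |Q i t|) (fun t _ => sub_self _)
    (fun i => ?_) (fun i t _ => ?_) hθe.tendsto
    ((hθe.mul_subExp (hx.subExp_psi_zero hS₀).norm).add hQe) i
  · refine ⟨(hx.psi i).1.sub fun t ht => (hx.psi_zero t ht).continuousWithinAt, fun t ht => ?_⟩
    refine (((hx.psi i).2 t ht).sub
      ((hx.psi_zero t ht).mono (Ici_subset_Ici.2 ht))).congr_deriv ?_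
    simp only [sub_sub_sub_cancel_right, smul_eq_mul, hQ, LinearMap.neg_apply,
      LinearMap.smul_apply, LinearMap.id_coe, id_eq]
    ring
  · have h1 : |x.alpha i.succ t - F.alpha0| ≤ θ t :=
      Finset.single_le_sum (f := fun i : Fin N => |x.alpha i.succ t - F.alpha0|)
        (fun i _ => abs_nonneg _) (Finset.mem_univ i)
    have h2 : |Q i t| ≤ ∑ i, |Q i t| :=
      Finset.single_le_sum (f := fun i => |Q i t|) (fun i _ => abs_nonneg _) (Finset.mem_univ i)
    have h3 : ‖x.psi i.succ t‖ ≤ ‖x.psi i.succ t - x.psi 0 t‖ + ‖x.psi 0 t‖ := by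
      simpa using norm_add_le (x.psi i.succ t - x.psi 0 t) (x.psi 0 t)
    have h0 : 0 ≤ θ t := (abs_nonneg _).trans h1
    calc ‖-(x.alpha i.succ t - F.alpha0) * x.psi i.succ t - Q i t‖
        ≤ |x.alpha i.succ t - F.alpha0| * ‖x.psi i.succ t‖ + |Q i t| := by
          refine (norm_sub_le _ _).trans (le_of_eq ?_)
          rw [norm_mul, norm_neg, Real.norm_eq_abs, Real.norm_eq_abs, Real.norm_eq_abs]
      _ ≤ θ t * (‖x.psi i.succ t - x.psi 0 t‖ + ‖x.psi 0 t‖) + ∑ i, |Q i t| := by gcongr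
      _ = _ := by ring

/-- The observed rate of change of the reference state of energy. -/
theorem expDecay_rate (hx : IsClosedLoop F S₀ C₀ net sig g x) (hconn : JointlyConnected net sig)
    (hS₀ : NoEigenvalueWithPosRe S₀) (i : Fin (N + 1)) :
    ExpDecay fun t => (-x.alpha i t * x.psi i t - x.beta i t * x.pRef i t)
      - (-F.alpha0 * x.psi 0 t - F.beta0 * x.pRef 0 t) := by
  have hα := hx.expDecay_alpha hconn i
  have hψ := hx.expDecay_psi hconn hS₀ i
  refine (((hα.mul_subExp hψ.subExp).add (hα.mul_subExp (hx.subExp_psi_zero hS₀))).add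
    (hψ.const_mul F.alpha0)).neg.sub (hx.expDecay_beta_mul_pRef hconn hS₀ i) |>.congr
    fun t _ => ?_
  ring

/-- Substituting the control law cancels the friction term and leaves tracking of ψ_i with gain κ.
-/
theorem hasDerivWithinAt_phi (hx : IsClosedLoop F S₀ C₀ net sig g x) (i : Fin N) {t : ℝ}
    (ht : 0 ≤ t) : HasDerivWithinAt (x.phi i)
      (-x.alpha i.succ t * x.psi i.succ t - x.beta i.succ t * x.pRef i.succ t
        - g.kappa * (x.phi i t - x.psi i.succ t)) (Ici 0) t := by
  refine (hx.phi i t ht).congr_deriv ?_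
  have h1 := (F.inertia_pos i).ne'
  have h2 := (F.gamma_pos i).ne'
  simp only [Signals.pOut]
  field_simp
  ring

/-- The tracking error solves ż = -κ z + h, where h combines the rate error and κ (ψ_i - ψ_0). -/
theorem expDecay_phi (hx : IsClosedLoop F S₀ C₀ net sig g x) (hconn : JointlyConnected net sig)
    (hS₀ : NoEigenvalueWithPosRe S₀) (i : Fin N) :
    ExpDecay fun t => x.phi i t - x.psi 0 t := by
  refine ExpDecay.of_solves g.kappa_pos ⟨fun t ht =>
      ((hx.phi i t ht).continuousWithinAt.sub (hx.psi_zero t ht).continuousWithinAt),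
      fun t ht => ?_⟩
    ((hx.expDecay_rate hconn hS₀ i.succ).add
      ((hx.expDecay_psi hconn hS₀ i.succ).const_mul g.kappa))
  refine (((hx.hasDerivWithinAt_phi i ht).sub (hx.psi_zero t ht)).mono
    (Ici_subset_Ici.2 ht)).congr_deriv ?_
  ring

/-- Compares the derivatives of φ_i and ψ_0; both the power objective and the derivative balance
rest on it. -/
theorem expDecay_deriv_phi (hx : IsClosedLoop F S₀ C₀ net sig g x)
    (hconn : JointlyConnected net sig) (hS₀ : NoEigenvalueWithPosRe S₀) (i : Fin N) :
    ExpDecay fun t => (-x.alpha i.succ t * x.psi i.succ t - x.beta i.succ t * x.pRef i.succ t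
      - g.kappa * (x.phi i t - x.psi i.succ t))
      - (-F.alpha0 * x.psi 0 t - F.beta0 * x.pRef 0 t) := by
  refine ((hx.expDecay_rate hconn hS₀ i.succ).sub (((hx.expDecay_phi hconn hS₀ i).sub
    (hx.expDecay_psi hconn hS₀ i.succ)).const_mul g.kappa)).congr fun t _ => ?_
  ring

end IsClosedLoop

/-! ### Power balance and the dual objective -/

/-- The reference trajectory distributes exactly the reference power. -/
theorem Flywheels.sum_reference_power (hN : 1 ≤ N) (F : Flywheels N) (ψ P : ℝ) :
    ∑ i, -(F.inertia i / (2 * F.gamma i)) *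
      ((-F.alpha0 * ψ - F.beta0 * P) + 2 * F.friction i / F.inertia i * ψ) = P := by
  have hne : (Finset.univ : Finset (Fin N)).Nonempty := ⟨⟨0, hN⟩, Finset.mem_univ _⟩
  have hJ : 0 < ∑ i, F.inertia i / F.gamma i :=
    Finset.sum_pos (fun i _ => div_pos (F.inertia_pos i) (F.gamma_pos i)) hne
  have h1 : ∀ i, -(F.inertia i / (2 * F.gamma i)) *
      ((-F.alpha0 * ψ - F.beta0 * P) + 2 * F.friction i / F.inertia i * ψ)
      = F.inertia i / F.gamma i * ((F.alpha0 * ψ + F.beta0 * P) / 2)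
        - F.friction i / F.gamma i * ψ := by
    intro i
    have h1 := (F.inertia_pos i).ne'
    have h2 := (F.gamma_pos i).ne'
    field_simp
    ring
  rw [Finset.sum_congr rfl fun i _ => h1 i, Finset.sum_sub_distrib, ← Finset.sum_mul,
    ← Finset.sum_mul]
  -- With J = ∑ I_i/γ_i one has J α₀/2 = ∑ B_{vi}/γ_i, so the ψ terms cancel, and J β₀/2 = 1.
  simp only [Flywheels.alpha0, Flywheels.beta0]
  field_simp
  ring

end FESMS

theorem theorem1 {N q n : ℕ} (hN : 1 ≤ N)
    (F : FESMS.Flywheels N)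
    (S₀ : Matrix (Fin q) (Fin q) ℝ) (C₀ : Fin q → ℝ)
    (net : FESMS.Network N n) (sig : FESMS.SwitchingSignal n)
    (hconn : FESMS.JointlyConnected net sig)
    (hS₀ : FESMS.NoEigenvalueWithPosRe S₀)
    (g : FESMS.Gains)
    (x : FESMS.Signals N q)
    (hx : FESMS.IsClosedLoop F S₀ C₀ net sig g x) :
    FESMS.DualObjective (x.pFESMS F g) (x.pRef 0) x.phi := by
  refine ⟨?_, fun i j _ => ?_, fun i j _ => ?_⟩
  · have h : FESMS.ExpDecay fun t => ∑ i, -(F.inertia i / (2 * F.gamma i)) *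
        (((-x.alpha i.succ t * x.psi i.succ t - x.beta i.succ t * x.pRef i.succ t
          - g.kappa * (x.phi i t - x.psi i.succ t))
          - (-F.alpha0 * x.psi 0 t - F.beta0 * x.pRef 0 t))
          + 2 * F.friction i / F.inertia i * (x.phi i t - x.psi 0 t)) :=
      FESMS.ExpDecay.sum fun i _ => ((hx.expDecay_deriv_phi hconn hS₀ i).add
        ((hx.expDecay_phi hconn hS₀ i).const_mul _)).const_mul _
    refine h.tendsto.congr fun t => ?_
    -- The reference power becomes a sum over flywheels of outputs along ψ_0, so the power error is
    -- a termwise combination of the errors of φ_i and its derivative.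
    conv_rhs => rw [← F.sum_reference_power hN (x.psi 0 t) (x.pRef 0 t)]
    rw [FESMS.Signals.pFESMS, ← Finset.sum_sub_distrib]
    refine Finset.sum_congr rfl fun i _ => ?_
    simp only [FESMS.Signals.pOut]
    ring
  · refine ((hx.expDecay_phi hconn hS₀ i).sub (hx.expDecay_phi hconn hS₀ j)).tendsto.congr
      fun t => ?_
    ring
  · refine ((hx.expDecay_deriv_phi hconn hS₀ i).sub
      (hx.expDecay_deriv_phi hconn hS₀ j)).tendsto.congr' ?_
    -- Only for t > 0 is the derivative within [0, ∞) two-sided.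
    filter_upwards [Filter.eventually_gt_atTop 0] with t ht
    rw [((hx.hasDerivWithinAt_phi i ht.le).hasDerivAt (Ici_mem_nhds ht)).deriv,
      ((hx.hasDerivWithinAt_phi j ht.le).hasDerivAt (Ici_mem_nhds ht)).deriv]
    ring
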